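/- Let $x_\star^{(1)}\in\mathbb R^{d_1}\setminus\{0\}$ and $x_\star^{(2)}\in\mathbb R^{d_2}\setminus\{0\}$ with $\|x_\star^{(1)}\|=\|x_\star^{(2)}\|$, and put $d=d_1+d_2$. Write $x_\star\in\mathbb R^d$ for the concatenation of $x_\star^{(1)}$ and $x_\star^{(2)}$, and $x_\star^-$ for the concatenation of $x_\star^{(1)}$ and $-x_\star^{(2)}$. Let $a_i^{(1)}\sim\mathrm{Normal}(0,I_{d_1})$ and $a_i^{(2)}\sim\mathrm{Normal}(0,I_{d_2})$, $i=1,\dots,n$, all be independent, let $a_i^{\pm}\in\mathbb R^d$ be the concatenation of $a_i^{(1)}$ and $\pm a_i^{(2)}$, let $$y_i=\langle a_i^{(1)},x_\star^{(1)}\rangle\langle x_\star^{(2)},a_i^{(2)}\rangle,\qquad f_i^{\pm}(x)=\tfrac14|\langle a_i^{\pm},x\rangle|^2,$$ and let $f^\pm$ be defined in the same way from an independent pair $(a^{(1)},a^{(2)})$ with the same law. Define $$\lambda_{\mathcal D}=\inf_{z\in\mathcal S}\ \tfrac12\,\mathbb E\,\big|\langle\nabla f^+(x_\star)-\nabla f^-(x_\star),z\rangle\big|,\qquad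 \mathcal S=\{z\in\mathbb R^d:\ \|z\|=1,\ |\langle z,x_\star^-\rangle|\le\tfrac12\|x_\star\|\}.$$ (Replacing $x_\star$ by $-x_\star$ does not change $y_i$ or $\lambda_{\mathcal D}$.) Let $S_n=\frac1{2n}\sum_{i=1}^n y_i\,(a_i^+\otimes a_i^+-a_i^-\otimes a_i^-)$. For every $\varepsilon\in(0,1)$ there are constants $C_\varepsilon,c_\varepsilon>0$ that depend only on $\varepsilon$ such that, for all $d_1,d_2$, all $x_\star$ as above, all $\delta\in(0,1]$ and all $$n\ \ge\ C_\varepsilon\Big(d+\log\frac4\delta\Big)\log d,$$ the following holds with probability at least $1-c_\varepsilon d^{-2}$. A top eigenpair of $S_n$, that is, its largest eigenvalue $\lambda_{\max}$ together with a unit eigenvector $v_{\max}$ for it, exists, and for every top eigenpair $(\lambda_{\max},v_{\max})$ one has $\lambda_{\max}\ge0$ and the vector $a_0=(\lambda_{\max}/2)^{1/2}v_{\max}$ satisfies the approximation-oracle condition: if $\langle v_{\max},x_\star\rangle\ge0$, then $$\Big\|a_0-\frac1{2n}\sum_{i=1}^n\big(\nabla f_i^+(x_\star)+\nabla f_i^-(x_\star)\big)\Big\|\le\frac{1-\varepsilon}2\,\lambda_{\mathcal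 D},$$ and if $\langle v_{\max},x_\star\rangle\le0$, then the same bound holds with $-x_\star$ in place of $x_\star$. -/

import Mathlib

open MeasureTheory ProbabilityTheory

noncomputable section

/-- The concatenation of `p = (p⁽¹⁾, p⁽²⁾)`, a vector of `ℝ^(d₁+d₂)` with its Euclidean norm.
For a design pair `a` this is `a⁺`; for the signal pair `x⋆` it is the vector `x⋆`. -/
def concatPos {d₁ d₂ : ℕ} (p : EuclideanSpace ℝ (Fin d₁) × EuclideanSpace ℝ (Fin d₂)) :
    EuclideanSpace ℝ (Fin d₁ ⊕ Fin d₂) :=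
  WithLp.toLp 2 (Sum.elim (fun j => p.1 j) (fun j => p.2 j))

/-- The concatenation of `p⁽¹⁾` and `-p⁽²⁾`: the vectors `a⁻` and `x⋆⁻`. -/
def concatNeg {d₁ d₂ : ℕ} (p : EuclideanSpace ℝ (Fin d₁) × EuclideanSpace ℝ (Fin d₂)) :
    EuclideanSpace ℝ (Fin d₁ ⊕ Fin d₂) :=
  concatPos (p.1, -p.2)

/-- The joint law of a design pair `(a⁽¹⁾, a⁽²⁾)`: independent standard normal vectors. -/
def designLaw (d₁ d₂ : ℕ) :
    Measure (EuclideanSpace ℝ (Fin d₁) × EuclideanSpace ℝ (Fin d₂)) :=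
  (stdGaussian (EuclideanSpace ℝ (Fin d₁))).prod (stdGaussian (EuclideanSpace ℝ (Fin d₂)))

/-- The noiseless bilinear measurement `⟨a⁽¹⁾, x⋆⁽¹⁾⟩ ⟨x⋆⁽²⁾, a⁽²⁾⟩`. -/
def bilinearObs {d₁ d₂ : ℕ} (x a : EuclideanSpace ℝ (Fin d₁) × EuclideanSpace ℝ (Fin d₂)) : ℝ :=
  inner ℝ a.1 x.1 * inner ℝ x.2 a.2

/-- `f⁺(z) = |⟨a⁺, z⟩|² / 4`. -/
def fPos {d₁ d₂ : ℕ} (a : EuclideanSpace ℝ (Fin d₁) × EuclideanSpace ℝ (Fin d₂))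
    (z : EuclideanSpace ℝ (Fin d₁ ⊕ Fin d₂)) : ℝ :=
  1 / 4 * |inner ℝ (concatPos a) z| ^ 2

/-- `f⁻(z) = |⟨a⁻, z⟩|² / 4`. -/
def fNeg {d₁ d₂ : ℕ} (a : EuclideanSpace ℝ (Fin d₁) × EuclideanSpace ℝ (Fin d₂))
    (z : EuclideanSpace ℝ (Fin d₁ ⊕ Fin d₂)) : ℝ :=
  1 / 4 * |inner ℝ (concatNeg a) z| ^ 2

/-- `q(h) = |⟨∇f⁺(x⋆) - ∇f⁻(x⋆), h⟩| / 2`, for the design pair `a`. -/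
def qFun {d₁ d₂ : ℕ} (x a : EuclideanSpace ℝ (Fin d₁) × EuclideanSpace ℝ (Fin d₂))
    (h : EuclideanSpace ℝ (Fin d₁ ⊕ Fin d₂)) : ℝ :=
  1 / 2 * |inner ℝ (gradient (fPos a) (concatPos x) - gradient (fNeg a) (concatPos x)) h|

/-- The restriction set: unit vectors `z` with `|⟨z, x⋆⁻⟩| ≤ ‖x⋆‖ / 2`. -/
def restrictionSet {d₁ d₂ : ℕ} (x : EuclideanSpace ℝ (Fin d₁) × EuclideanSpace ℝ (Fin d₂)) :
    Set (EuclideanSpace ℝ (Fin d₁ ⊕ Fin d₂)) :=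
  {z | ‖z‖ = 1 ∧ |inner ℝ z (concatNeg x)| ≤ 1 / 2 * ‖concatPos x‖}

/-- `λ_D`, the infimum of `𝔼 q(z)` over the restriction set. -/
def lambdaD {d₁ d₂ : ℕ} (x : EuclideanSpace ℝ (Fin d₁) × EuclideanSpace ℝ (Fin d₂)) : ℝ :=
  sInf ((fun z => ∫ a, qFun x a z ∂(designLaw d₁ d₂)) '' restrictionSet x)

/-- The approximation-oracle condition with parameter `ε` for the vector `a₀`, the ground truth
`x` and the design pairs `a 0, …, a (n-1)`. -/
def IsApproxOracle {d₁ d₂ n : ℕ} (ε : ℝ)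
    (x : EuclideanSpace ℝ (Fin d₁) × EuclideanSpace ℝ (Fin d₂))
    (a : Fin n → EuclideanSpace ℝ (Fin d₁) × EuclideanSpace ℝ (Fin d₂))
    (a₀ : EuclideanSpace ℝ (Fin d₁ ⊕ Fin d₂)) : Prop :=
  ‖a₀ - (1 / (2 * (n : ℝ))) •
      ∑ i, (gradient (fPos (a i)) (concatPos x) + gradient (fNeg (a i)) (concatPos x))‖
    ≤ (1 - ε) / 2 * lambdaD x

/-- `S_n = (2n)⁻¹ ∑ yᵢ (aᵢ⁺ ⊗ aᵢ⁺ - aᵢ⁻ ⊗ aᵢ⁻)`, with `yᵢ` the bilinear measurements of `x`. -/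
def spectralMatrix {d₁ d₂ n : ℕ} (x : EuclideanSpace ℝ (Fin d₁) × EuclideanSpace ℝ (Fin d₂))
    (a : Fin n → EuclideanSpace ℝ (Fin d₁) × EuclideanSpace ℝ (Fin d₂)) :
    Matrix (Fin d₁ ⊕ Fin d₂) (Fin d₁ ⊕ Fin d₂) ℝ :=
  (1 / (2 * (n : ℝ))) • ∑ i, bilinearObs x (a i) •
    (Matrix.vecMulVec (concatPos (a i)).ofLp (concatPos (a i)).ofLp
      - Matrix.vecMulVec (concatNeg (a i)).ofLp (concatNeg (a i)).ofLp)

/-- `lam` is the largest (real) eigenvalue of `S`, and `v` is a unit eigenvector for it. -/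
def IsTopEigenpair {ι : Type*} [Fintype ι] [DecidableEq ι] (S : Matrix ι ι ℝ) (lam : ℝ)
    (v : EuclideanSpace ℝ ι) : Prop :=
  IsGreatest {μ : ℝ | Module.End.HasEigenvalue (Matrix.toEuclideanLin S) μ} lam ∧
    Module.End.HasEigenvector (Matrix.toEuclideanLin S) lam v ∧ ‖v‖ = 1

/-- The spectral anchor `a₀ = (lam / 2)^(1/2) v`. -/
def spectralAnchor {ι : Type*} (lam : ℝ) (v : EuclideanSpace ℝ ι) : EuclideanSpace ℝ ι :=
  Real.sqrt (lam / 2) • v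

end

/-! Write `x = (R u, R w)` with unit `u`, `w`, so that `‖x‖² = 2R²`. The quadratic form of `S_n` at
`(p, q)` is `2/n` times the sum of the products `⟨a⁽¹⁾,x⁽¹⁾⟩⟨a⁽²⁾,x⁽²⁾⟩⟨a⁽¹⁾,p⟩⟨a⁽²⁾,q⟩`, with mean
`2R²⟨u,p⟩⟨w,q⟩`. On the unit sphere this mean is at most `R²`, with equality only at `± x/‖x‖`.
Hence a uniform error `e²R²` forces `λ_max ≈ R²` and `v_max ≈ ± x/‖x‖`, that is `a₀ ≈ ± x/2`, up to
`2eR` (`norm_sqrt_smul_sub_half_le`). The averaged gradients also have mean `x/2` and deviate by at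
most `e²R`. Since `λ_D ≥ cR` for an absolute `c` (`le_lambdaD`), taking `e` proportional to `(1-ε)c`
suffices.

The probabilistic core is `measureReal_not_momentsClose_le`. A product of four Gaussian coordinates
has no exponential moment, so the two factors in the fixed directions `u`, `w` are truncated at a
level `T` of order `n/d`. The truncated product is subexponential at scale `T`, and Bernstein's
bound beats the `5^d` points of a product of nets. The truncation is inactive on all samples except
with probability of order `n e^{-T/4}`; this term is what requires the factor `log d` and yields the
rate `d^{-2}`.

The bound on `λ_D` is a second-versus-fourth-moment comparison: the restriction set keeps the second
moment of the relevant bilinear form away from zero, and its fourth moment is bounded. -/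

/-! ### Nets and the norms of linear and bilinear forms. -/

/-- The unit ball of a `d`-dimensional normed space has a `1/2`-net of at most `5 ^ d` points. -/
lemma exists_half_net (E : Type*) [NormedAddCommGroup E] [NormedSpace ℝ E]
    [FiniteDimensional ℝ E] :
    ∃ N : Finset E, (∀ p ∈ N, ‖p‖ ≤ 1) ∧ N.card ≤ 5 ^ Module.finrank ℝ E ∧
      ∀ v : E, ‖v‖ ≤ 1 → ∃ p ∈ N, ‖v - p‖ ≤ 1 / 2 := by
  classical
  let sep : Finset E → Prop := fun N =>
    (∀ p ∈ N, ‖p‖ ≤ 1) ∧ ∀ p ∈ N, ∀ q ∈ N, p ≠ q → 1 / 2 ≤ ‖p - q‖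
  have hcard : ∀ N, sep N → N.card ≤ 5 ^ Module.finrank ℝ E := by
    intro N hN
    -- Doubling turns separation `1/2` in the unit ball into separation `1` in the ball of radius
    -- `2`, the normalisation of the packing bound.
    have h2 : Function.Injective (fun p : E => (2 : ℝ) • p) :=
      smul_right_injective E (two_ne_zero)
    rw [← Finset.card_image_of_injective N h2]
    apply Besicovitch.card_le_of_separated
    · intro c hc
      obtain ⟨p, hp, rfl⟩ := Finset.mem_image.1 hc
      rw [norm_smul]
      have := hN.1 p hp
      norm_num
      linarith
    · intro c hc d hd hcd
      obtain ⟨p, hp, rfl⟩ := Finset.mem_image.1 hc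
      obtain ⟨q, hq, rfl⟩ := Finset.mem_image.1 hd
      have hpq : p ≠ q := fun h => hcd (by rw [h])
      have := hN.2 p hp q hq hpq
      simp only [← smul_sub, norm_smul]
      norm_num
      linarith
  -- A separated set of maximal cardinality is a net: a point far from all of it could be added.
  obtain ⟨N, hN, hNk⟩ := Nat.findGreatest_spec (P := fun k => ∃ N, sep N ∧ N.card = k)
    (Nat.zero_le (5 ^ Module.finrank ℝ E)) ⟨∅, by simp [sep], rfl⟩
  refine ⟨N, hN.1, hcard N hN, fun v hv => ?_⟩
  by_contra! hfar
  have hvN : v ∉ N := fun h => by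
    have := hfar v h
    norm_num at this
  have hins : sep (insert v N) := by
    refine ⟨fun p hp => ?_, fun p hp q hq hpq => ?_⟩
    · rcases Finset.mem_insert.1 hp with rfl | hp
      exacts [hv, hN.1 p hp]
    · rcases Finset.mem_insert.1 hp with h1 | h1 <;> rcases Finset.mem_insert.1 hq with h2 | h2
      · exact absurd (h1.trans h2.symm) hpq
      · rw [h1]
        exact (hfar q h2).le
      · rw [h2, norm_sub_rev]
        exact (hfar p h1).le
      · exact hN.2 p h1 q h2 hpq
  have := Nat.le_findGreatest (P := fun k => ∃ N, sep N ∧ N.card = k) (hcard _ hins)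
    ⟨_, hins, rfl⟩
  rw [Finset.card_insert_of_notMem hvN] at this
  omega

/-- A linear functional that is small on a `1/2`-net of the unit ball is small. -/
lemma IsLinearMap.abs_le_of_half_net {E : Type*} [NormedAddCommGroup E] [NormedSpace ℝ E]
    [FiniteDimensional ℝ E] {N : Set E}
    (hN : ∀ v : E, ‖v‖ ≤ 1 → ∃ p ∈ N, ‖v - p‖ ≤ 1 / 2) {f : E → ℝ} (hf : IsLinearMap ℝ f)
    {M : ℝ} (hM : 0 ≤ M) (h : ∀ p ∈ N, |f p| ≤ M) (v : E) : |f v| ≤ 2 * M * ‖v‖ := by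
  let L : E →L[ℝ] ℝ := LinearMap.toContinuousLinearMap hf.mk'
  have hL : ∀ v, L v = f v := fun _ => rfl
  have key : ‖L‖ ≤ M + ‖L‖ / 2 := by
    refine L.opNorm_le_of_unit_norm (by positivity) fun w hw => ?_
    obtain ⟨p, hp, hpw⟩ := hN w hw.le
    have h1 : L w = L p + L (w - p) := by simp
    have h2 := L.le_opNorm (w - p)
    have h3 : ‖L p‖ ≤ M := h p hp
    rw [h1]
    refine (norm_add_le _ _).trans (add_le_add h3 (h2.trans ?_))
    nlinarith [norm_nonneg L]
  have h1 := L.le_opNorm v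
  rw [← hL, ← Real.norm_eq_abs]
  nlinarith [norm_nonneg v]

/-- A bilinear form that is small on `1/2`-nets of the unit balls is small. -/
lemma abs_bilin_le_of_half_net {E F : Type*} [NormedAddCommGroup E] [NormedSpace ℝ E]
    [FiniteDimensional ℝ E] [NormedAddCommGroup F] [NormedSpace ℝ F] [FiniteDimensional ℝ F]
    {N : Set E} {N' : Set F}
    (hN : ∀ v : E, ‖v‖ ≤ 1 → ∃ p ∈ N, ‖v - p‖ ≤ 1 / 2)
    (hN' : ∀ v : F, ‖v‖ ≤ 1 → ∃ p ∈ N', ‖v - p‖ ≤ 1 / 2)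
    {f : E → F → ℝ} (hf : ∀ p, IsLinearMap ℝ (f p)) (hf' : ∀ q, IsLinearMap ℝ fun p => f p q)
    {M : ℝ} (hM : 0 ≤ M) (h : ∀ p ∈ N, ∀ q ∈ N', |f p q| ≤ M) (v : E) (w : F) :
    |f v w| ≤ 4 * M * ‖v‖ * ‖w‖ := by
  have h1 : ∀ p ∈ N, |f p w| ≤ 2 * M * ‖w‖ := fun p hp =>
    (hf p).abs_le_of_half_net hN' hM (h p hp) w
  have h2 := (hf' w).abs_le_of_half_net hN (by positivity) h1 v
  linarith

/-! ### A Bernstein inequality from a dominated exponential moment. -/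

lemma Real.exp_le_one_add_add_sq_mul_exp_abs (x : ℝ) :
    Real.exp x ≤ 1 + x + x ^ 2 * Real.exp |x| := by
  have h := Complex.norm_exp_sub_sum_le_norm_mul_exp (x : ℂ) 2
  have h2 : Complex.exp (x : ℂ) - ∑ m ∈ Finset.range 2, (x : ℂ) ^ m / (m.factorial : ℂ)
      = ((Real.exp x - (1 + x) : ℝ) : ℂ) := by
    simp [Finset.sum_range_succ]
  rw [h2, Complex.norm_real, Complex.norm_real, Real.norm_eq_abs, Real.norm_eq_abs, sq_abs] at h
  linarith [le_abs_self (Real.exp x - (1 + x))]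

lemma exp_mul_le_of_sq_mul_exp_le {S : Type*} {f g : S → ℝ} {s : ℝ} (hs : 0 ≤ s)
    (hfg : ∀ z, f z ^ 2 * Real.exp (s * |f z|) ≤ g z) (z : S) :
    Real.exp (s * f z) ≤ 1 + s * f z + s ^ 2 * g z := by
  have h := Real.exp_le_one_add_add_sq_mul_exp_abs (s * f z)
  rw [abs_mul, abs_of_nonneg hs] at h
  have := mul_le_mul_of_nonneg_left (hfg z) (sq_nonneg s)
  nlinarith

section Bernstein

variable {Ω S : Type*} [MeasurableSpace Ω] [MeasurableSpace S] {P : Measure Ω}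
  [IsProbabilityMeasure P] {n : ℕ} {a : Fin n → Ω → S} {μ : Measure S} [IsProbabilityMeasure μ]
  {f g : S → ℝ} {s K : ℝ}

lemma integrable_of_sq_mul_exp_le (hf : Measurable f) (hg : Integrable g μ) (hs : 0 ≤ s)
    (hfg : ∀ z, f z ^ 2 * Real.exp (s * |f z|) ≤ g z) : Integrable f μ := by
  refine Integrable.mono' ((integrable_const (1 : ℝ)).add hg) hf.aestronglyMeasurable
    (.of_forall fun z => ?_)
  have h1 : (1 : ℝ) ≤ Real.exp (s * |f z|) := Real.one_le_exp (by positivity)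
  have h2 := hfg z
  have h3 : f z ^ 2 ≤ f z ^ 2 * Real.exp (s * |f z|) := le_mul_of_one_le_right (sq_nonneg _) h1
  simp only [Pi.add_apply, Real.norm_eq_abs]
  nlinarith [sq_abs (f z), sq_nonneg (|f z| - 1)]

/-- Chernoff's method with the second-order Taylor bound `e^{sf} ≤ 1 + sf + s²g`. The linear term
produces the mean, so `f` need not be centred. The parameter `s` stays free because the truncated
products and the quadratic terms need different choices. -/
lemma measureReal_le_sum_le_exp (ha : ∀ i, HasLaw (a i) μ P) (hind : iIndepFun a P)
    (hf : Measurable f) (hg : Integrable g μ) (hs : 0 ≤ s)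
    (hfg : ∀ z, f z ^ 2 * Real.exp (s * |f z|) ≤ g z) (hK : ∫ z, g z ∂μ ≤ K) (t : ℝ) :
    P.real {ω | n * (∫ z, f z ∂μ + t) ≤ ∑ i, f (a i ω)}
      ≤ Real.exp (-(n * (s * t - s ^ 2 * K))) := by
  have hfi := integrable_of_sq_mul_exp_le hf hg hs hfg
  have hdom : Integrable (fun z => 1 + s * f z + s ^ 2 * g z) μ :=
    ((integrable_const _).add (hfi.const_mul _)).add (hg.const_mul _)
  have hexp : Integrable (fun z => Real.exp (s * f z)) μ := by
    refine hdom.mono' (by fun_prop) (.of_forall fun z => ?_)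
    rw [Real.norm_eq_abs, Real.abs_exp]
    exact exp_mul_le_of_sq_mul_exp_le hs hfg z
  have hmgf : mgf f μ s ≤ Real.exp (s * ∫ z, f z ∂μ + s ^ 2 * K) := by
    calc mgf f μ s ≤ ∫ z, (1 + s * f z + s ^ 2 * g z) ∂μ :=
          integral_mono hexp hdom (exp_mul_le_of_sq_mul_exp_le hs hfg)
      _ = 1 + s * ∫ z, f z ∂μ + s ^ 2 * ∫ z, g z ∂μ := by
          have h1 : ∫ z, (1 + s * f z) + s ^ 2 * g z ∂μ
              = ∫ z, (1 + s * f z) ∂μ + ∫ z, s ^ 2 * g z ∂μ :=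
            integral_add ((integrable_const _).add (hfi.const_mul _)) (hg.const_mul _)
          have h2 : ∫ z, (1 + s * f z) ∂μ = ∫ _z, (1 : ℝ) ∂μ + ∫ z, s * f z ∂μ :=
            integral_add (integrable_const _) (hfi.const_mul _)
          rw [h1, h2, integral_const_mul, integral_const_mul]
          simp
      _ ≤ (s * ∫ z, f z ∂μ + s ^ 2 * K) + 1 := by
          have := mul_le_mul_of_nonneg_left hK (sq_nonneg s)
          linarith
      _ ≤ _ := Real.add_one_le_exp _
  have hind' : iIndepFun (fun i ω => f (a i ω)) P := hind.comp (fun _ => f) (fun _ => hf)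
  have hmeas : ∀ i, AEMeasurable (fun ω => f (a i ω)) P := fun i =>
    hf.comp_aemeasurable (ha i).aemeasurable
  have hmgf' : ∀ i, mgf (fun ω => f (a i ω)) P s = mgf f μ s := fun i =>
    (ha i).integral_comp (f := fun z => Real.exp (s * f z)) (by fun_prop)
  have hint' : ∀ i, Integrable (fun ω => Real.exp (s * f (a i ω))) P := fun i => by
    have : Integrable (fun z => Real.exp (s * f z)) (P.map (a i)) := by
      rw [(ha i).map_eq]; exact hexp
    exact this.comp_aemeasurable (ha i).aemeasurable
  have hsum : mgf (∑ i, fun ω => f (a i ω)) P s = ∏ _i : Fin n, mgf f μ s := by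
    rw [hind'.mgf_sum₀ hmeas]
    exact Finset.prod_congr rfl fun i _ => hmgf' i
  have hmgfpos : 0 < mgf f μ s := mgf_pos hexp
  have hintsum : Integrable (fun ω => Real.exp (s * (∑ i, fun ω => f (a i ω)) ω)) P := by
    -- A non-integrable exponential would have Bochner integral `0`, whereas the product of the
    -- individual moment generating functions is positive.
    by_contra hcon
    have h0 : mgf (∑ i, fun ω => f (a i ω)) P s = 0 := integral_undef hcon
    rw [hsum] at h0
    exact (Finset.prod_pos fun i _ => hmgfpos).ne' h0
  have hch := measure_ge_le_exp_mul_mgf (μ := P) (X := ∑ i, fun ω => f (a i ω))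
    (n * (∫ z, f z ∂μ + t)) hs hintsum
  rw [hsum] at hch
  simp only [Finset.sum_apply, Finset.prod_const, Finset.card_univ, Fintype.card_fin] at hch
  refine hch.trans ?_
  calc Real.exp (-s * (n * (∫ z, f z ∂μ + t))) * mgf f μ s ^ n
      ≤ Real.exp (-s * (n * (∫ z, f z ∂μ + t))) * Real.exp (s * ∫ z, f z ∂μ + s ^ 2 * K) ^ n := by
        gcongr
    _ = _ := by
        rw [← Real.exp_nat_mul, ← Real.exp_add]
        ring_nf

/-- A Bernstein-type bound: sums of independent variables `f (a i)` whose exponential moment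
`f² e^{s|f|}` has mean at most `K`. -/
lemma measureReal_le_abs_sum_sub_le_exp (ha : ∀ i, HasLaw (a i) μ P) (hind : iIndepFun a P)
    (hf : Measurable f) (hg : Integrable g μ) (hs : 0 ≤ s)
    (hfg : ∀ z, f z ^ 2 * Real.exp (s * |f z|) ≤ g z) (hK : ∫ z, g z ∂μ ≤ K) (t : ℝ) :
    P.real {ω | n * t ≤ |∑ i, f (a i ω) - n * ∫ z, f z ∂μ|}
      ≤ 2 * Real.exp (-(n * (s * t - s ^ 2 * K))) := by
  have h1 := measureReal_le_sum_le_exp ha hind hf hg hs hfg hK t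
  have h2 := measureReal_le_sum_le_exp (f := fun z => - f z) ha hind hf.neg hg hs
    (fun z => by simpa using hfg z) hK t
  rw [two_mul]
  refine le_trans ?_ ((measureReal_union_le _ _).trans (add_le_add h1 h2))
  refine measureReal_mono fun ω hω => ?_
  simp only [Set.mem_ofPred_eq, Set.mem_union, integral_neg, Finset.sum_neg_distrib] at hω ⊢
  rcases le_abs.1 hω with h | h
  · left; linarith
  · right; linarith

end Bernstein

/-! ### Exponential moments of Gaussian coordinates. -/

/-- The exponential moment `𝔼 exp (3 g² / 8)` of a standard normal variable. -/
noncomputable def gaussianExpMoment : ℝ := ∫ x, Real.exp (3 / 8 * x ^ 2) ∂(gaussianReal 0 1)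

lemma integrable_exp_sq_gaussianReal {θ : ℝ} (hθ : θ < 1 / 2) :
    Integrable (fun x => Real.exp (θ * x ^ 2)) (gaussianReal 0 1) := by
  rw [gaussianReal_of_var_ne_zero _ one_ne_zero, gaussianPDF_def]
  rw [integrable_withDensity_iff (by fun_prop) (by simp)]
  have h := (integrable_exp_neg_mul_sq (b := 1 / 2 - θ) (by linarith)).const_mul
    (Real.sqrt (2 * Real.pi))⁻¹
  refine h.congr (.of_forall fun x => ?_)
  beta_reduce
  rw [ENNReal.toReal_ofReal (gaussianPDFReal_nonneg _ _ _), gaussianPDFReal]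
  simp only [NNReal.coe_one, sub_zero, mul_one]
  rw [mul_left_comm, ← Real.exp_add]
  ring_nf

lemma one_le_gaussianExpMoment : 1 ≤ gaussianExpMoment := by
  calc (1 : ℝ) = ∫ _x, (1 : ℝ) ∂(gaussianReal 0 1) := by simp
    _ ≤ _ := integral_mono (integrable_const _)
      (integrable_exp_sq_gaussianReal (by norm_num)) fun x => Real.one_le_exp (by positivity)

section StdGaussian

variable {E : Type*} [NormedAddCommGroup E] [InnerProductSpace ℝ E] [FiniteDimensional ℝ E]
  [MeasurableSpace E] [BorelSpace E]

lemma map_inner_stdGaussian (p : E) :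
    (stdGaussian E).map (fun a => inner ℝ a p) = (gaussianReal 0 1).map (fun x => ‖p‖ * x) := by
  have h := IsGaussian.map_eq_gaussianReal (μ := stdGaussian E) (innerSL ℝ p)
  rw [variance_dual_stdGaussian, integral_strongDual_stdGaussian, innerSL_apply_norm] at h
  rw [gaussianReal_map_const_mul]
  have h2 : (fun a => inner ℝ a p) = (innerSL ℝ p : E → ℝ) := by
    ext a
    rw [innerSL_apply_apply, real_inner_comm]
  rw [h2, h]
  congr 1
  · simp
  · ext
    simp

lemma integrable_exp_inner_sq {θ : ℝ} (hθ : θ ≤ 3 / 8) {p : E} (hp : ‖p‖ ≤ 1) :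
    Integrable (fun a => Real.exp (θ * inner ℝ a p ^ 2)) (stdGaussian E) ∧
      ∫ a, Real.exp (θ * inner ℝ a p ^ 2) ∂(stdGaussian E) ≤ gaussianExpMoment := by
  have hint : Integrable (fun x => Real.exp (θ * (‖p‖ * x) ^ 2)) (gaussianReal 0 1) := by
    have := integrable_exp_sq_gaussianReal (θ := θ * ‖p‖ ^ 2)
      (by nlinarith [norm_nonneg p])
    refine this.congr (.of_forall fun x => ?_)
    ring_nf
  have hm : Measurable (fun a : E => inner ℝ a p) := by fun_prop
  constructor
  · have : Integrable (fun y => Real.exp (θ * y ^ 2))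
        ((stdGaussian E).map (fun a => inner ℝ a p)) := by
      rw [map_inner_stdGaussian, integrable_map_measure (by fun_prop) (by fun_prop)]
      exact hint
    exact this.comp_measurable hm
  · have h1 := integral_map (μ := stdGaussian E) (f := fun y : ℝ => Real.exp (θ * y ^ 2))
      hm.aemeasurable (by fun_prop)
    rw [← h1, map_inner_stdGaussian, integral_map (by fun_prop) (by fun_prop)]
    refine integral_mono hint (integrable_exp_sq_gaussianReal (by norm_num)) fun x => ?_
    apply Real.exp_le_exp.2
    rw [mul_pow, ← mul_assoc]
    have : ‖p‖ ^ 2 ≤ 1 := by nlinarith [norm_nonneg p]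
    have : θ * ‖p‖ ^ 2 ≤ 3 / 8 := by nlinarith
    nlinarith [sq_nonneg x]

/-- The coordinates along `p` and `q` may be correlated, so independence is replaced by `yz ≤ (y² +
z²)/2`; this halves the exponent `3/8` to `3/16`. -/
lemma integrable_exp_inner_sq_add {p q : E} (hp : ‖p‖ ≤ 1) (hq : ‖q‖ ≤ 1) :
    Integrable (fun a => Real.exp (3 / 16 * (inner ℝ a p ^ 2 + inner ℝ a q ^ 2)))
        (stdGaussian E) ∧
      ∫ a, Real.exp (3 / 16 * (inner ℝ a p ^ 2 + inner ℝ a q ^ 2)) ∂(stdGaussian E)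
        ≤ gaussianExpMoment := by
  obtain ⟨hpi, hpm⟩ := integrable_exp_inner_sq le_rfl hp
  obtain ⟨hqi, hqm⟩ := integrable_exp_inner_sq le_rfl hq
  have hle : ∀ a : E, Real.exp (3 / 16 * (inner ℝ a p ^ 2 + inner ℝ a q ^ 2)) ≤
      1 / 2 * Real.exp (3 / 8 * inner ℝ a p ^ 2) + 1 / 2 * Real.exp (3 / 8 * inner ℝ a q ^ 2) := by
    intro a
    have h1 : Real.exp (3 / 16 * (inner ℝ a p ^ 2 + inner ℝ a q ^ 2)) =
      Real.exp (3 / 16 * inner ℝ a p ^ 2) * Real.exp (3 / 16 * inner ℝ a q ^ 2) := by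
      rw [← Real.exp_add]; ring_nf
    have h2 : ∀ y : ℝ, Real.exp (3 / 8 * y) = Real.exp (3 / 16 * y) ^ 2 := by
      intro y
      rw [← Real.exp_nat_mul]
      push_cast
      ring_nf
    rw [h1, h2, h2]
    nlinarith [sq_nonneg (Real.exp (3 / 16 * inner ℝ a p ^ 2)
      - Real.exp (3 / 16 * inner ℝ a q ^ 2))]
  have hdom := (hpi.const_mul (1 / 2)).add (hqi.const_mul (1 / 2))
  have hint : Integrable (fun a => Real.exp (3 / 16 * (inner ℝ a p ^ 2 + inner ℝ a q ^ 2)))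
        (stdGaussian E) := by
    refine hdom.mono' (by fun_prop) (.of_forall fun a => ?_)
    rw [Real.norm_eq_abs, Real.abs_exp]
    exact hle a
  refine ⟨hint, (integral_mono hint hdom hle).trans ?_⟩
  rw [integral_add' (hpi.const_mul (1 / 2)) (hqi.const_mul (1 / 2)), integral_const_mul,
    integral_const_mul]
  linarith

lemma integral_inner_mul_inner_stdGaussian (p q : E) :
    ∫ a, inner ℝ a p * inner ℝ a q ∂(stdGaussian E) = inner ℝ p q := by
  have h := covarianceBilin_apply_eq_cov (μ := stdGaussian E) IsGaussian.memLp_two_id p q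
  rw [covarianceBilin_stdGaussian, innerSL_apply_apply, covariance] at h
  have hz : ∀ r : E, ∫ a, inner ℝ r a ∂(stdGaussian E) = 0 := fun r =>
    integral_strongDual_stdGaussian (innerSL ℝ r)
  rw [h]
  simp only [hz, sub_zero, real_inner_comm]

end StdGaussian

/-! ### Products of Gaussian coordinates: domination, truncation, means. -/

section Weight

variable {d₁ d₂ : ℕ} {u p : EuclideanSpace ℝ (Fin d₁)} {w q : EuclideanSpace ℝ (Fin d₂)}

instance : IsProbabilityMeasure (designLaw d₁ d₂) := by
  unfold designLaw; infer_instance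

/-- An integrable weight that dominates the polynomials of the four variables `⟨a⁽¹⁾, u⟩`,
`⟨a⁽¹⁾, p⟩`, `⟨a⁽²⁾, w⟩`, `⟨a⁽²⁾, q⟩`. -/
noncomputable def expWeight (u p : EuclideanSpace ℝ (Fin d₁)) (w q : EuclideanSpace ℝ (Fin d₂))
    (a : EuclideanSpace ℝ (Fin d₁) × EuclideanSpace ℝ (Fin d₂)) : ℝ :=
  Real.exp (3 / 16 * (inner ℝ a.1 u ^ 2 + inner ℝ a.1 p ^ 2)) *
    Real.exp (3 / 16 * (inner ℝ a.2 w ^ 2 + inner ℝ a.2 q ^ 2))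

lemma expWeight_eq (a : EuclideanSpace ℝ (Fin d₁) × EuclideanSpace ℝ (Fin d₂)) :
    expWeight u p w q a = Real.exp (3 / 16 * (inner ℝ a.1 u ^ 2 + inner ℝ a.1 p ^ 2
      + inner ℝ a.2 w ^ 2 + inner ℝ a.2 q ^ 2)) := by
  rw [expWeight, ← Real.exp_add]
  ring_nf

lemma integrable_expWeight (hu : ‖u‖ ≤ 1) (hp : ‖p‖ ≤ 1) (hw : ‖w‖ ≤ 1) (hq : ‖q‖ ≤ 1) :
    Integrable (expWeight u p w q) (designLaw d₁ d₂) :=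
  (integrable_exp_inner_sq_add hu hp).1.mul_prod (integrable_exp_inner_sq_add hw hq).1

lemma integral_expWeight_le (hu : ‖u‖ ≤ 1) (hp : ‖p‖ ≤ 1) (hw : ‖w‖ ≤ 1) (hq : ‖q‖ ≤ 1) :
    ∫ a, expWeight u p w q a ∂(designLaw d₁ d₂) ≤ gaussianExpMoment ^ 2 := by
  have h := integral_prod_mul (μ := stdGaussian (EuclideanSpace ℝ (Fin d₁)))
    (ν := stdGaussian (EuclideanSpace ℝ (Fin d₂)))
    (fun b => Real.exp (3 / 16 * (inner ℝ b u ^ 2 + inner ℝ b p ^ 2)))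
    (fun b => Real.exp (3 / 16 * (inner ℝ b w ^ 2 + inner ℝ b q ^ 2)))
  have h1 := (integrable_exp_inner_sq_add hu hp).2
  have h2 := (integrable_exp_inner_sq_add hw hq).2
  unfold designLaw expWeight
  rw [h, sq]
  exact mul_le_mul h1 h2 (integral_nonneg fun _ => (Real.exp_pos _).le)
    (zero_le_one.trans one_le_gaussianExpMoment)

lemma one_le_expWeight (a : EuclideanSpace ℝ (Fin d₁) × EuclideanSpace ℝ (Fin d₂)) :
    1 ≤ expWeight u p w q a := by
  rw [expWeight_eq]
  exact Real.one_le_exp (by positivity)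

/-- The exponent budget is `3/16` per squared coordinate: polynomial factors cost `1/16`, which
leaves `1/8` for an exponential of a product of two coordinates. -/
lemma Real.one_add_sq_le_exp (x : ℝ) : 1 + x ^ 2 ≤ 16 * Real.exp (x ^ 2 / 16) := by
  have := Real.add_one_le_exp (x ^ 2 / 16)
  linarith

lemma Real.sq_le_exp (x : ℝ) : x ^ 2 ≤ 16 * Real.exp (x ^ 2 / 16) := by
  have := Real.one_add_sq_le_exp x
  linarith

lemma Real.abs_le_exp (x : ℝ) : |x| ≤ 16 * Real.exp (x ^ 2 / 16) := by
  have := Real.one_add_sq_le_exp x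
  nlinarith [sq_abs x, sq_nonneg (|x| - 1)]

lemma Real.abs_mul_le_sq_add_sq (x y : ℝ) : |x * y| ≤ (x ^ 2 + y ^ 2) / 2 := by
  rw [abs_mul]
  nlinarith [sq_abs x, sq_abs y, sq_nonneg (|x| - |y|)]

lemma sq_mul_exp_le_exp (x y : ℝ) :
    (x * y) ^ 2 * Real.exp (1 / 4 * |x * y|) ≤
      16 ^ 2 * Real.exp (3 / 16 * (x ^ 2 + y ^ 2)) := by
  have h1 : (x * y) ^ 2 ≤ 16 ^ 2 * Real.exp ((x ^ 2 + y ^ 2) / 16) := by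
    have h := mul_le_mul (Real.sq_le_exp x) (Real.sq_le_exp y) (sq_nonneg _) (by positivity)
    rw [add_div, Real.exp_add]
    linarith
  have h2 : Real.exp (1 / 4 * |x * y|) ≤ Real.exp ((x ^ 2 + y ^ 2) / 8) :=
    Real.exp_le_exp.2 (by linarith [Real.abs_mul_le_sq_add_sq x y])
  refine (mul_le_mul h1 h2 (Real.exp_pos _).le (by positivity)).trans_eq ?_
  rw [mul_assoc, ← Real.exp_add]
  ring_nf

lemma sq_mul_exp_fst_le_expWeight (a : EuclideanSpace ℝ (Fin d₁) × EuclideanSpace ℝ (Fin d₂)) :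
    (inner ℝ a.1 u * inner ℝ a.1 p) ^ 2 * Real.exp (1 / 4 * |inner ℝ a.1 u * inner ℝ a.1 p|)
      ≤ 16 ^ 4 * expWeight u p w q a := by
  refine (sq_mul_exp_le_exp _ _).trans ?_
  refine mul_le_mul (by norm_num) ?_ (Real.exp_pos _).le (by norm_num)
  exact le_mul_of_one_le_right (Real.exp_pos _).le (Real.one_le_exp (by positivity))

lemma sq_mul_exp_snd_le_expWeight (a : EuclideanSpace ℝ (Fin d₁) × EuclideanSpace ℝ (Fin d₂)) :
    (inner ℝ a.2 w * inner ℝ a.2 q) ^ 2 * Real.exp (1 / 4 * |inner ℝ a.2 w * inner ℝ a.2 q|)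
      ≤ 16 ^ 4 * expWeight u p w q a := by
  refine (sq_mul_exp_le_exp _ _).trans ?_
  refine mul_le_mul (by norm_num) ?_ (Real.exp_pos _).le (by norm_num)
  exact le_mul_of_one_le_left (Real.exp_pos _).le (Real.one_le_exp (by positivity))

lemma exp_abs_mul_le_expWeight (a : EuclideanSpace ℝ (Fin d₁) × EuclideanSpace ℝ (Fin d₂)) :
    Real.exp (1 / 4 * |inner ℝ a.1 u * inner ℝ a.2 w|) ≤ expWeight u p w q a := by
  rw [expWeight_eq]
  apply Real.exp_le_exp.2
  have := Real.abs_mul_le_sq_add_sq (inner ℝ a.1 u) (inner ℝ a.2 w)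
  nlinarith [sq_nonneg (inner ℝ a.1 u : ℝ), sq_nonneg (inner ℝ a.1 p : ℝ),
    sq_nonneg (inner ℝ a.2 w : ℝ), sq_nonneg (inner ℝ a.2 q : ℝ)]

lemma mul_four_le_exp {A B X Y : ℝ} {α β P Q : ℝ} (hA : A ≤ 16 * Real.exp (α ^ 2 / 16))
    (hB : B ≤ 16 * Real.exp (β ^ 2 / 16)) (hX : X ≤ 16 * Real.exp (P ^ 2 / 16))
    (hY : Y ≤ 16 * Real.exp (Q ^ 2 / 16)) (hA0 : 0 ≤ A) (hB0 : 0 ≤ B) (hX0 : 0 ≤ X)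
    (hY0 : 0 ≤ Y) :
    A * B * (X * Y) ≤ 16 ^ 4 * Real.exp ((α ^ 2 + β ^ 2 + P ^ 2 + Q ^ 2) / 16) := by
  have h1 := mul_le_mul hA hB hB0 (hA0.trans hA)
  have h2 := mul_le_mul hX hY hY0 (hX0.trans hX)
  refine (mul_le_mul h1 h2 (by positivity) (by positivity)).trans_eq ?_
  have : (α ^ 2 + β ^ 2 + P ^ 2 + Q ^ 2) / 16
    = α ^ 2 / 16 + β ^ 2 / 16 + (P ^ 2 / 16 + Q ^ 2 / 16) := by ring
  rw [this, Real.exp_add, Real.exp_add, Real.exp_add]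
  ring

/-- The extra factor `|⟨a⁽¹⁾,u⟩⟨a⁽²⁾,w⟩|` exceeds `T` wherever the truncation acts, so the discarded
part is at most the weight divided by `T`. -/
lemma abs_mul_abs_le_expWeight (a : EuclideanSpace ℝ (Fin d₁) × EuclideanSpace ℝ (Fin d₂)) :
    |inner ℝ a.1 u * inner ℝ a.2 w| * |inner ℝ a.1 u * inner ℝ a.2 w
      * (inner ℝ a.1 p * inner ℝ a.2 q)| ≤ 16 ^ 4 * expWeight u p w q a := by
  have h := mul_four_le_exp (Real.sq_le_exp (inner ℝ a.1 u)) (Real.sq_le_exp (inner ℝ a.2 w))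
    (Real.abs_le_exp (inner ℝ a.1 p)) (Real.abs_le_exp (inner ℝ a.2 q)) (sq_nonneg _)
    (sq_nonneg _) (abs_nonneg _) (abs_nonneg _)
  have h2 : |inner ℝ a.1 u * inner ℝ a.2 w| * |inner ℝ a.1 u * inner ℝ a.2 w
      * (inner ℝ a.1 p * inner ℝ a.2 q)|
      = inner ℝ a.1 u ^ 2 * inner ℝ a.2 w ^ 2 * (|inner ℝ a.1 p| * |inner ℝ a.2 q|) := by
    simp only [abs_mul]
    rw [← sq_abs (inner ℝ a.1 u), ← sq_abs (inner ℝ a.2 w)]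
    ring
  rw [h2, expWeight_eq]
  refine h.trans (mul_le_mul_of_nonneg_left (Real.exp_le_exp.2 ?_) (by norm_num))
  nlinarith [sq_nonneg (inner ℝ a.1 u : ℝ), sq_nonneg (inner ℝ a.1 p : ℝ),
    sq_nonneg (inner ℝ a.2 w : ℝ), sq_nonneg (inner ℝ a.2 q : ℝ)]

/-- The product `⟨a⁽¹⁾, u⟩⟨a⁽²⁾, w⟩⟨a⁽¹⁾, p⟩⟨a⁽²⁾, q⟩`, truncated where the first two factors
have a product above `T`. -/
noncomputable def truncProd (T : ℝ) (u p : EuclideanSpace ℝ (Fin d₁))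
    (w q : EuclideanSpace ℝ (Fin d₂))
    (a : EuclideanSpace ℝ (Fin d₁) × EuclideanSpace ℝ (Fin d₂)) : ℝ :=
  if |inner ℝ a.1 u * inner ℝ a.2 w| ≤ T then
    inner ℝ a.1 u * inner ℝ a.2 w * (inner ℝ a.1 p * inner ℝ a.2 q) else 0

lemma measurable_truncProd (T : ℝ) : Measurable (truncProd T u p w q) := by
  unfold truncProd
  exact Measurable.ite (measurableSet_le (by fun_prop) (by fun_prop)) (by fun_prop) (by fun_prop)

/-- Where the product is kept, its first two factors contribute at most `T`, so the exponent is at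
most a quarter of `|⟨a⁽¹⁾,p⟩⟨a⁽²⁾,q⟩|`: a product of two Gaussian coordinates instead of four. -/
lemma sq_mul_exp_truncProd_le_expWeight {T : ℝ} (hT : 0 < T)
    (a : EuclideanSpace ℝ (Fin d₁) × EuclideanSpace ℝ (Fin d₂)) :
    truncProd T u p w q a ^ 2 * Real.exp (1 / (4 * T) * |truncProd T u p w q a|)
      ≤ 16 ^ 4 * expWeight u p w q a := by
  unfold truncProd
  split_ifs with h
  · set α : ℝ := inner ℝ a.1 u with hα
    set β : ℝ := inner ℝ a.2 w with hβ
    set X : ℝ := inner ℝ a.1 p with hX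
    set Y : ℝ := inner ℝ a.2 q with hY
    have h1 : 1 / (4 * T) * |α * β * (X * Y)| ≤ (X ^ 2 + Y ^ 2) / 8 := by
      have h2 := Real.abs_mul_le_sq_add_sq X Y
      rw [abs_mul, div_mul_eq_mul_div, one_mul, div_le_iff₀ (by positivity)]
      have h3 := mul_le_mul h h2 (abs_nonneg _) hT.le
      linarith
    have h2 := mul_four_le_exp (Real.sq_le_exp α) (Real.sq_le_exp β)
      (Real.sq_le_exp X) (Real.sq_le_exp Y) (sq_nonneg _) (sq_nonneg _) (sq_nonneg _) (sq_nonneg _)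
    have h3 : (α * β * (X * Y)) ^ 2 = α ^ 2 * β ^ 2 * (X ^ 2 * Y ^ 2) := by ring
    rw [h3, expWeight_eq]
    refine (mul_le_mul h2 (Real.exp_le_exp.2 h1) (Real.exp_pos _).le (by positivity)).trans ?_
    rw [mul_assoc, ← Real.exp_add]
    refine mul_le_mul_of_nonneg_left (Real.exp_le_exp.2 ?_) (by norm_num)
    nlinarith [sq_nonneg α, sq_nonneg β]
  · have := one_le_expWeight (u := u) (p := p) (w := w) (q := q) a
    norm_num
    linarith

lemma integrable_inner_mul_inner (u p : EuclideanSpace ℝ (Fin d₁)) :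
    Integrable (fun a => inner ℝ a u * inner ℝ a p)
      (stdGaussian (EuclideanSpace ℝ (Fin d₁))) := by
  have h : ∀ r : EuclideanSpace ℝ (Fin d₁), MemLp (fun a => inner ℝ a r) 2
      (stdGaussian (EuclideanSpace ℝ (Fin d₁))) := fun r =>
    (IsGaussian.memLp_two_id (μ := stdGaussian (EuclideanSpace ℝ (Fin d₁)))).inner_const r
  exact (h u).integrable_mul (h p)

lemma integral_prod_inner (u p : EuclideanSpace ℝ (Fin d₁)) (w q : EuclideanSpace ℝ (Fin d₂)) :
    Integrable (fun a => inner ℝ a.1 u * inner ℝ a.2 w * (inner ℝ a.1 p * inner ℝ a.2 q))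
      (designLaw d₁ d₂) ∧
    ∫ a, inner ℝ a.1 u * inner ℝ a.2 w * (inner ℝ a.1 p * inner ℝ a.2 q) ∂(designLaw d₁ d₂)
      = inner ℝ u p * inner ℝ w q := by
  have h : (fun a : EuclideanSpace ℝ (Fin d₁) × EuclideanSpace ℝ (Fin d₂) =>
      inner ℝ a.1 u * inner ℝ a.2 w * (inner ℝ a.1 p * inner ℝ a.2 q))
      = fun a => (inner ℝ a.1 u * inner ℝ a.1 p) * (inner ℝ a.2 w * inner ℝ a.2 q) := by
    ext a; ring
  rw [h]
  constructor
  · exact (integrable_inner_mul_inner u p).mul_prod (integrable_inner_mul_inner w q)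
  · rw [← integral_inner_mul_inner_stdGaussian u p, ← integral_inner_mul_inner_stdGaussian w q]
    exact integral_prod_mul (fun a : EuclideanSpace ℝ (Fin d₁) => inner ℝ a u * inner ℝ a p)
      (fun a : EuclideanSpace ℝ (Fin d₂) => inner ℝ a w * inner ℝ a q)

lemma integral_fst_inner (u p : EuclideanSpace ℝ (Fin d₁)) :
    ∫ a, inner ℝ a.1 u * inner ℝ a.1 p ∂(designLaw d₁ d₂) = inner ℝ u p := by
  rw [← integral_inner_mul_inner_stdGaussian u p]
  unfold designLaw
  rw [integral_fun_fst (fun a : EuclideanSpace ℝ (Fin d₁) => inner ℝ a u * inner ℝ a p)]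
  simp

lemma integral_snd_inner (w q : EuclideanSpace ℝ (Fin d₂)) :
    ∫ a, inner ℝ a.2 w * inner ℝ a.2 q ∂(designLaw d₁ d₂) = inner ℝ w q := by
  rw [← integral_inner_mul_inner_stdGaussian w q]
  unfold designLaw
  rw [integral_fun_snd (fun a : EuclideanSpace ℝ (Fin d₂) => inner ℝ a w * inner ℝ a q)]
  simp

/-- The constant that bounds the moments of this file. -/
noncomputable def momentConst : ℝ := 16 ^ 4 * gaussianExpMoment ^ 2

lemma le_momentConst : 16 ^ 4 ≤ momentConst := by
  have := one_le_gaussianExpMoment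
  unfold momentConst
  nlinarith

lemma integral_const_mul_expWeight_le (hu : ‖u‖ ≤ 1) (hp : ‖p‖ ≤ 1) (hw : ‖w‖ ≤ 1)
    (hq : ‖q‖ ≤ 1) :
    ∫ a, 16 ^ 4 * expWeight u p w q a ∂(designLaw d₁ d₂) ≤ momentConst := by
  rw [integral_const_mul]
  exact mul_le_mul_of_nonneg_left (integral_expWeight_le hu hp hw hq) (by norm_num)

lemma abs_integral_truncProd_sub_le (hu : ‖u‖ ≤ 1) (hp : ‖p‖ ≤ 1) (hw : ‖w‖ ≤ 1) (hq : ‖q‖ ≤ 1)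
    {T : ℝ} (hT : 0 < T) :
    |∫ a, truncProd T u p w q a ∂(designLaw d₁ d₂) - inner ℝ u p * inner ℝ w q|
      ≤ momentConst / T := by
  have hW := (integrable_expWeight hu hp hw hq).const_mul (16 ^ 4)
  have hint : Integrable (truncProd T u p w q) (designLaw d₁ d₂) :=
    integrable_of_sq_mul_exp_le (measurable_truncProd T) hW (s := 1 / (4 * T)) (by positivity)
      (sq_mul_exp_truncProd_le_expWeight hT)
  obtain ⟨hi, hm⟩ := integral_prod_inner u p w q
  rw [← hm, ← integral_sub hint hi]
  refine (abs_integral_le_integral_abs).trans ?_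
  calc _ ≤ ∫ a, (16 ^ 4 * expWeight u p w q a) / T ∂(designLaw d₁ d₂) := by
        refine integral_mono (hint.sub hi).abs (hW.div_const T) fun a => ?_
        have h1 := abs_mul_abs_le_expWeight (u := u) (p := p) (w := w) (q := q) a
        have h2 := one_le_expWeight (u := u) (p := p) (w := w) (q := q) a
        beta_reduce
        rw [le_div_iff₀ hT]
        unfold truncProd
        split_ifs with h
        · simp only [sub_self, abs_zero, zero_mul]
          linarith
        · rw [zero_sub, abs_neg]
          refine le_trans ?_ h1
          rw [mul_comm]
          exact mul_le_mul_of_nonneg_right (not_le.1 h).le (abs_nonneg _)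
    _ ≤ _ := by
        rw [integral_div]
        exact div_le_div_of_nonneg_right (integral_const_mul_expWeight_le hu hp hw hq) hT.le

/-- Markov's inequality for `expWeight` at level `e^{T/4}`. -/
lemma measureReal_lt_abs_mul_le (hu : ‖u‖ ≤ 1) (hw : ‖w‖ ≤ 1) (T : ℝ) :
    (designLaw d₁ d₂).real {a | T < |inner ℝ a.1 u * inner ℝ a.2 w|}
      ≤ gaussianExpMoment ^ 2 * Real.exp (-(T / 4)) := by
  have h := mul_meas_ge_le_integral_of_nonneg
    (.of_forall fun a => zero_le_one.trans (one_le_expWeight a))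
    (integrable_expWeight hu hu hw hw) (Real.exp (T / 4))
  have h2 := h.trans (integral_expWeight_le hu hu hw hw)
  rw [Real.exp_neg, ← div_eq_mul_inv, le_div_iff₀' (Real.exp_pos _)]
  refine le_trans (mul_le_mul_of_nonneg_left (measureReal_mono fun a ha => ?_)
    (Real.exp_pos _).le) h2
  refine le_trans (Real.exp_le_exp.2 ?_) (exp_abs_mul_le_expWeight a)
  have : T < |inner ℝ a.1 u * inner ℝ a.2 w| := ha
  linarith

end Weight

/-! ### Uniform concentration of the empirical moments. -/

/-- Since `5 ≤ e²`, the left side is at most `e^{-d}`, and `e^d ≥ d²/2`. -/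
lemma five_pow_mul_exp_le (d : ℕ) (hd : 0 < d) :
    (5 : ℝ) ^ d * Real.exp (-(3 * d)) ≤ 2 * ((d : ℝ) ^ 2)⁻¹ := by
  have h5 : (5 : ℝ) ≤ Real.exp 2 := by
    have h := Real.exp_one_gt_d9
    have : Real.exp 2 = Real.exp 1 ^ 2 := by rw [← Real.exp_nat_mul]; norm_num
    rw [this]
    nlinarith
  have h1 : (5 : ℝ) ^ d ≤ Real.exp (2 * d) := by
    rw [mul_comm, Real.exp_nat_mul]
    gcongr
  have hd' : (0 : ℝ) < d := by exact_mod_cast hd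
  calc (5 : ℝ) ^ d * Real.exp (-(3 * d)) ≤ Real.exp (2 * d) * Real.exp (-(3 * d)) := by gcongr
    _ = (Real.exp d)⁻¹ := by rw [← Real.exp_add, ← Real.exp_neg]; ring_nf
    _ ≤ ((d : ℝ) ^ 2 / 2)⁻¹ := by
        gcongr
        have := Real.quadratic_le_exp_of_nonneg hd'.le
        linarith
    _ = _ := by rw [inv_div, div_eq_mul_inv]

/-- Put `z = κn/(2d)`. One factor `e^{-z}` absorbs `z`, which is `n` up to the factor `2d/κ`; the
other is at most `d^{-3}` because `z ≥ 3 log d`. The remaining factor `d` leaves `d^{-2}`. -/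
lemma mul_exp_neg_le {d n κ : ℝ} (hd : 1 ≤ d) (hκ : 0 < κ)
    (hn : 6 / κ * d * Real.log d ≤ n) :
    n * Real.exp (-(κ * (n / d))) ≤ 2 / κ * (d ^ 2)⁻¹ := by
  have hd0 : 0 < d := by linarith
  set z := κ * (n / d) / 2 with hz
  have hnz : n = 2 / κ * d * z := by rw [hz]; field_simp
  have h1 : z ≤ Real.exp z := by linarith [Real.add_one_le_exp z]
  have h2 : 3 * Real.log d ≤ z := by
    have : 6 / κ * d * Real.log d = 2 / κ * d * (3 * Real.log d) := by ring
    rw [this, hnz] at hn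
    exact le_of_mul_le_mul_left hn (by positivity)
  have h3 : Real.exp (-z) ≤ (d ^ 3)⁻¹ := by
    rw [← Real.exp_log hd0, ← Real.exp_nat_mul, ← Real.exp_neg]
    apply Real.exp_le_exp.2
    push_cast
    simpa using h2
  have h4 : κ * (n / d) = z + z := by rw [hz]; ring
  calc n * Real.exp (-(κ * (n / d))) = 2 / κ * d * (z * Real.exp (-z)) * Real.exp (-z) := by
        rw [h4, neg_add, Real.exp_add, hnz]; ring
    _ ≤ 2 / κ * d * 1 * (d ^ 3)⁻¹ := by
        have h5 : z * Real.exp (-z) ≤ 1 := by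
          rw [Real.exp_neg, ← div_eq_mul_inv, div_le_one (Real.exp_pos _)]
          exact h1
        gcongr
    _ = _ := by field_simp

section Concentration

variable {d₁ d₂ n : ℕ}

/-- The empirical moments of the design pairs `a` in the directions `u` and `w` are within `r`
of their means, uniformly over the unit balls. -/
structure MomentsClose (r : ℝ) (u : EuclideanSpace ℝ (Fin d₁)) (w : EuclideanSpace ℝ (Fin d₂))
    (a : Fin n → EuclideanSpace ℝ (Fin d₁) × EuclideanSpace ℝ (Fin d₂)) : Prop where
  prod : ∀ p q, |∑ i, inner ℝ (a i).1 u * inner ℝ (a i).2 w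
    * (inner ℝ (a i).1 p * inner ℝ (a i).2 q) - n * (inner ℝ u p * inner ℝ w q)|
      ≤ r * ‖p‖ * ‖q‖
  fst : ∀ p, |∑ i, inner ℝ (a i).1 u * inner ℝ (a i).1 p - n * inner ℝ u p| ≤ r * ‖p‖
  snd : ∀ q, |∑ i, inner ℝ (a i).2 w * inner ℝ (a i).2 q - n * inner ℝ w q| ≤ r * ‖q‖

/-- Passing from a net to the whole ball loses a factor `2` per variable; the `4` is the bilinear
loss, and also covers the two linear cases. -/
lemma momentsClose_of_half_net {u : EuclideanSpace ℝ (Fin d₁)} {w : EuclideanSpace ℝ (Fin d₂)}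
    {a : Fin n → EuclideanSpace ℝ (Fin d₁) × EuclideanSpace ℝ (Fin d₂)}
    {N : Set (EuclideanSpace ℝ (Fin d₁))} {N' : Set (EuclideanSpace ℝ (Fin d₂))}
    (hN : ∀ v, ‖v‖ ≤ 1 → ∃ p ∈ N, ‖v - p‖ ≤ 1 / 2)
    (hN' : ∀ v, ‖v‖ ≤ 1 → ∃ p ∈ N', ‖v - p‖ ≤ 1 / 2) {M : ℝ} (hM : 0 ≤ M)
    (hprod : ∀ p ∈ N, ∀ q ∈ N', |∑ i, inner ℝ (a i).1 u * inner ℝ (a i).2 w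
      * (inner ℝ (a i).1 p * inner ℝ (a i).2 q) - n * (inner ℝ u p * inner ℝ w q)| ≤ M)
    (hfst : ∀ p ∈ N, |∑ i, inner ℝ (a i).1 u * inner ℝ (a i).1 p - n * inner ℝ u p| ≤ M)
    (hsnd : ∀ q ∈ N', |∑ i, inner ℝ (a i).2 w * inner ℝ (a i).2 q - n * inner ℝ w q| ≤ M) :
    MomentsClose (4 * M) u w a := by
  have hlin : ∀ (d : ℕ) (b : Fin n → EuclideanSpace ℝ (Fin d)) (v : EuclideanSpace ℝ (Fin d))
      (c : Fin n → ℝ) (k : ℝ) (f : EuclideanSpace ℝ (Fin d) → ℝ),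
      (∀ p, f p = ∑ i, c i * inner ℝ (b i) p - k * inner ℝ v p) → IsLinearMap ℝ f := by
    intro d b v c k f hf
    constructor
    · intro x y
      simp only [hf, inner_add_right, mul_add, Finset.sum_add_distrib]
      ring
    · intro s x
      simp only [hf, inner_smul_right, smul_eq_mul, mul_sub, Finset.mul_sum]
      congr 1
      · exact Finset.sum_congr rfl fun i _ => by ring
      · ring
  refine ⟨fun p q => ?_, fun p => ?_, fun q => ?_⟩
  · refine abs_bilin_le_of_half_net hN hN' (f := fun p q => ∑ i, inner ℝ (a i).1 u
      * inner ℝ (a i).2 w * (inner ℝ (a i).1 p * inner ℝ (a i).2 q)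
      - n * (inner ℝ u p * inner ℝ w q)) (fun p => ?_) (fun q => ?_) hM hprod p q
    · refine hlin d₂ (fun i => (a i).2) w
        (fun i => inner ℝ (a i).1 u * inner ℝ (a i).2 w * inner ℝ (a i).1 p)
        (n * inner ℝ u p) _ fun x => ?_
      simp only [mul_assoc]
    · refine hlin d₁ (fun i => (a i).1) u
        (fun i => inner ℝ (a i).1 u * inner ℝ (a i).2 w * inner ℝ (a i).2 q)
        (n * inner ℝ w q) _ fun x => ?_
      simp only [mul_assoc, mul_comm (inner ℝ w q), mul_comm (inner ℝ _ q)]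
  · have := (hlin d₁ (fun i => (a i).1) u (fun i => inner ℝ (a i).1 u) n _
      fun _ => rfl).abs_le_of_half_net hN hM hfst p
    nlinarith [norm_nonneg p, mul_nonneg hM (norm_nonneg p)]
  · have := (hlin d₂ (fun i => (a i).2) w (fun i => inner ℝ (a i).2 w) n _
      fun _ => rfl).abs_le_of_half_net hN' hM hsnd q
    nlinarith [norm_nonneg q, mul_nonneg hM (norm_nonneg q)]

lemma measureReal_not_momentsClose_le {t : ℝ} (ht : 0 < t) (ht' : t ≤ 1 / 2)
    (hd : 2 ≤ d₁ + d₂)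
    (hn : 48 * momentConst / t ^ 2 * ((d₁ + d₂ : ℕ) : ℝ) * Real.log ((d₁ + d₂ : ℕ) : ℝ) ≤ (n : ℝ))
    {u : EuclideanSpace ℝ (Fin d₁)} {w : EuclideanSpace ℝ (Fin d₂)} (hu : ‖u‖ ≤ 1) (hw : ‖w‖ ≤ 1)
    {Ω : Type*} [MeasurableSpace Ω] {P : Measure Ω} [IsProbabilityMeasure P]
    {a : Fin n → Ω → EuclideanSpace ℝ (Fin d₁) × EuclideanSpace ℝ (Fin d₂)}
    (ha : ∀ i, HasLaw (a i) (designLaw d₁ d₂) P) (hind : iIndepFun a P) :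
    P.real {ω | ¬ MomentsClose (8 * t * n) u w (fun i => a i ω)}
      ≤ (192 / t * gaussianExpMoment ^ 2 + 12) * (((d₁ + d₂ : ℕ) : ℝ) ^ 2)⁻¹ := by
  obtain ⟨N, hN1, hNc, hN⟩ := exists_half_net (EuclideanSpace ℝ (Fin d₁))
  obtain ⟨N', hN1', hNc', hN'⟩ := exists_half_net (EuclideanSpace ℝ (Fin d₂))
  rw [finrank_euclideanSpace_fin] at hNc hNc'
  set d : ℕ := d₁ + d₂ with hd_def
  have hK := le_momentConst
  set K := momentConst with hK_def
  have hK1 : 1 ≤ K := le_trans (by norm_num) hK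
  have hd2 : (2 : ℝ) ≤ d := by exact_mod_cast hd
  have hlog : 1 / 2 ≤ Real.log d := by
    have h1 : Real.log 2 ≤ Real.log d := Real.log_le_log (by norm_num) hd2
    linarith [Real.log_two_gt_d9]
  have hnd : 24 * K / t ^ 2 * d ≤ n := by
    refine le_trans ?_ hn
    have h1 : 0 ≤ 48 * K / t ^ 2 * d := by positivity
    calc 24 * K / t ^ 2 * d = 48 * K / t ^ 2 * d * (1 / 2) := by ring
      _ ≤ _ := mul_le_mul_of_nonneg_left hlog h1
  have hn0 : (0 : ℝ) < n := lt_of_lt_of_le (by positivity) hnd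
  -- This level makes the Bernstein exponent `n t / (8T)` equal to `3d`, while the lower bound on
  -- `n` keeps the truncation bias `K / T` below `t`.
  set T : ℝ := t * n / (24 * d) with hT_def
  have hT : 0 < T := by positivity
  have hKT : K / T ≤ t := by
    rw [div_le_iff₀ hT, hT_def, ← mul_div_assoc, le_div_iff₀ (by positivity)]
    have h1 := mul_le_mul_of_nonneg_left hnd (sq_nonneg t)
    have h2 : t ^ 2 * (24 * K / t ^ 2 * d) = K * (24 * d) := by field_simp
    linarith
  let B0 : Set Ω := ⋃ i, {ω | T < |inner ℝ (a i ω).1 u * inner ℝ (a i ω).2 w|}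
  let B1 : Set Ω := ⋃ z ∈ N ×ˢ N', {ω | n * t ≤ |∑ i, truncProd T u z.1 w z.2 (a i ω)
    - n * ∫ b, truncProd T u z.1 w z.2 b ∂(designLaw d₁ d₂)|}
  let B2 : Set Ω := ⋃ p ∈ N, {ω | n * t ≤ |∑ i, inner ℝ (a i ω).1 u * inner ℝ (a i ω).1 p
    - n * ∫ b, inner ℝ b.1 u * inner ℝ b.1 p ∂(designLaw d₁ d₂)|}
  let B3 : Set Ω := ⋃ q ∈ N', {ω | n * t ≤ |∑ i, inner ℝ (a i ω).2 w * inner ℝ (a i ω).2 q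
    - n * ∫ b, inner ℝ b.2 w * inner ℝ b.2 q ∂(designLaw d₁ d₂)|}
  have hsub : {ω | ¬ MomentsClose (8 * t * n) u w (fun i => a i ω)} ⊆ B0 ∪ (B1 ∪ (B2 ∪ B3)) := by
    intro ω hω
    by_contra hcon
    simp only [Set.mem_union, not_or] at hcon
    obtain ⟨h0, h1, h2, h3⟩ := hcon
    simp only [B0, B1, B2, B3, Set.mem_iUnion, Set.mem_ofPred_eq, not_exists, not_lt, not_le,
      Finset.mem_product, Prod.forall, and_imp] at h0 h1 h2 h3
    refine hω ?_
    -- The net costs `4`; on the net, fluctuation and truncation bias contribute `t n` each.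
    have h8 : 8 * t * n = 4 * (2 * t * n) := by ring
    rw [h8]
    refine momentsClose_of_half_net (N := N) (N' := N') hN hN' (by positivity) (fun p hp q hq => ?_)
      (fun p hp => ?_) (fun q hq => ?_)
    · have hA := h1 p q hp hq
      have hsum : ∑ i, truncProd T u p w q (a i ω) = ∑ i, inner ℝ (a i ω).1 u * inner ℝ (a i ω).2 w
          * (inner ℝ (a i ω).1 p * inner ℝ (a i ω).2 q) :=
        Finset.sum_congr rfl fun i _ => if_pos (h0 i)
      rw [hsum] at hA
      have hB := (abs_integral_truncProd_sub_le hu (hN1 p hp) hw (hN1' q hq) hT).trans hKT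
      have hC : |n * ∫ b, truncProd T u p w q b ∂(designLaw d₁ d₂)
          - n * (inner ℝ u p * inner ℝ w q)| ≤ n * t := by
        rw [← mul_sub, abs_mul, abs_of_pos hn0]
        exact mul_le_mul_of_nonneg_left hB hn0.le
      have := abs_sub_le (∑ i, inner ℝ (a i ω).1 u * inner ℝ (a i ω).2 w
          * (inner ℝ (a i ω).1 p * inner ℝ (a i ω).2 q))
        (n * ∫ b, truncProd T u p w q b ∂(designLaw d₁ d₂)) (n * (inner ℝ u p * inner ℝ w q))
      linarith
    · have := h2 p hp
      rw [integral_fst_inner] at this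
      nlinarith
    · have := h3 q hq
      rw [integral_snd_inner] at this
      nlinarith
  have hexp0 : ∀ e : ℝ, 3 * d ≤ e → 2 * Real.exp (-e) ≤ 2 * Real.exp (-(3 * d)) := fun e he =>
    mul_le_mul_of_nonneg_left (Real.exp_le_exp.2 (neg_le_neg he)) (by norm_num)
  have hP0 : P.real B0 ≤ 192 / t * gaussianExpMoment ^ 2 * ((d : ℝ) ^ 2)⁻¹ := by
    refine (measureReal_iUnion_fintype_le _).trans ?_
    have h1 : ∀ i ∈ Finset.univ, P.real {ω | T < |inner ℝ (a i ω).1 u * inner ℝ (a i ω).2 w|}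
        ≤ gaussianExpMoment ^ 2 * Real.exp (-(T / 4)) := fun i _ => by
      have hm : MeasurableSet {z : EuclideanSpace ℝ (Fin d₁) × EuclideanSpace ℝ (Fin d₂) |
          T < |inner ℝ z.1 u * inner ℝ z.2 w|} :=
        measurableSet_lt (by fun_prop) (by fun_prop)
      rw [(ha i).measureReal_eq hm]
      exact measureReal_lt_abs_mul_le hu hw T
    refine (Finset.sum_le_sum h1).trans ?_
    rw [Finset.sum_const, Finset.card_univ, Fintype.card_fin, nsmul_eq_mul]
    have h2 : T / 4 = t / 96 * (n / d) := by rw [hT_def]; field_simp; norm_num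
    have h3 : 6 / (t / 96) * d * Real.log d ≤ n := by
      refine le_trans ?_ hn
      have h4 : 6 / (t / 96) ≤ 48 * K / t ^ 2 := by
        rw [div_div_eq_mul_div, div_le_div_iff₀ ht (by positivity)]
        nlinarith [mul_pos ht ht]
      gcongr
    have h5 := mul_exp_neg_le (by linarith) (by positivity) h3
    rw [h2]
    calc _ = gaussianExpMoment ^ 2 * (n * Real.exp (-(t / 96 * (n / d)))) := by ring
      _ ≤ gaussianExpMoment ^ 2 * (2 / (t / 96) * ((d : ℝ) ^ 2)⁻¹) := by gcongr
      _ = _ := by field_simp; ring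
  have hP1 : P.real B1 ≤ 5 ^ d * (2 * Real.exp (-(3 * d))) := by
    refine (measureReal_biUnion_finset_le _ _).trans ?_
    have h1 : ∀ z ∈ N ×ˢ N', P.real {ω | n * t ≤ |∑ i, truncProd T u z.1 w z.2 (a i ω)
        - n * ∫ b, truncProd T u z.1 w z.2 b ∂(designLaw d₁ d₂)|}
        ≤ 2 * Real.exp (-(3 * d)) := fun z hz => by
      obtain ⟨hz1, hz2⟩ := Finset.mem_product.1 hz
      have h2 := measureReal_le_abs_sum_sub_le_exp ha hind (measurable_truncProd T)
        ((integrable_expWeight hu (hN1 _ hz1) hw (hN1' _ hz2)).const_mul (16 ^ 4))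
        (s := 1 / (4 * T)) (by positivity) (sq_mul_exp_truncProd_le_expWeight hT)
        (integral_const_mul_expWeight_le hu (hN1 _ hz1) hw (hN1' _ hz2)) t
      refine h2.trans (hexp0 _ ?_)
      -- With `s = 1/(4T)`, the bound `K / T ≤ t` makes the quadratic loss at most a quarter of the
      -- gain `s t`.
      have h3 : 1 / (4 * T) * t - (1 / (4 * T)) ^ 2 * K ≥ t / (8 * T) := by
        have h4 : (1 / (4 * T)) ^ 2 * K = 1 / (16 * T) * (K / T) := by field_simp; norm_num
        have h5 : 1 / (16 * T) * (K / T) ≤ 1 / (16 * T) * t := by gcongr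
        have h6 : 1 / (4 * T) * t = 4 * (1 / (16 * T) * t) := by field_simp; norm_num
        have h7 : t / (8 * T) = 2 * (1 / (16 * T) * t) := by field_simp; norm_num
        have h8 : 0 < 1 / (16 * T) * t := by positivity
        linarith
      have h9 : n * (t / (8 * T)) = 3 * d := by
        rw [hT_def]; field_simp; norm_num
      calc 3 * (d : ℝ) = n * (t / (8 * T)) := h9.symm
        _ ≤ _ := mul_le_mul_of_nonneg_left h3 hn0.le
    refine (Finset.sum_le_sum h1).trans ?_
    rw [Finset.sum_const, nsmul_eq_mul, Finset.card_product]
    refine mul_le_mul_of_nonneg_right ?_ (by positivity)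
    rw [hd_def, pow_add]
    exact_mod_cast Nat.mul_le_mul hNc hNc'
  -- The quadratic moments need no truncation: `s = t/(2K)` maximises `st - s²K`, and `s ≤ 1/4`
  -- keeps it within the range of the weight bounds.
  have hs0 : 0 ≤ t / (2 * K) := by positivity
  have hs1 : t / (2 * K) ≤ 1 / 4 := by
    rw [div_le_iff₀ (by positivity)]
    linarith
  have hexp2 : 3 * (d : ℝ) ≤ n * (t / (2 * K) * t - (t / (2 * K)) ^ 2 * K) := by
    have h1 : t / (2 * K) * t - (t / (2 * K)) ^ 2 * K = t ^ 2 / (4 * K) := by field_simp; norm_num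
    have h2 : (24 * K / t ^ 2 * d) * (t ^ 2 / (4 * K)) = 6 * d := by field_simp; norm_num
    have h3 := mul_le_mul_of_nonneg_right hnd (show 0 ≤ t ^ 2 / (4 * K) by positivity)
    rw [h1]
    linarith
  have hmono : ∀ x : ℝ, x ^ 2 * Real.exp (t / (2 * K) * |x|) ≤ x ^ 2 * Real.exp (1 / 4 * |x|) :=
    fun x => by gcongr
  have hP2 : P.real B2 ≤ 5 ^ d * (2 * Real.exp (-(3 * d))) := by
    refine (measureReal_biUnion_finset_le _ _).trans ?_
    have h1 : ∀ p ∈ N, P.real {ω | n * t ≤ |∑ i, inner ℝ (a i ω).1 u * inner ℝ (a i ω).1 p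
        - n * ∫ b, inner ℝ b.1 u * inner ℝ b.1 p ∂(designLaw d₁ d₂)|}
        ≤ 2 * Real.exp (-(3 * d)) := fun p hp =>
      (measureReal_le_abs_sum_sub_le_exp (f := fun b => inner ℝ b.1 u * inner ℝ b.1 p) ha hind
        (by fun_prop) ((integrable_expWeight hu (hN1 _ hp) hw hw).const_mul (16 ^ 4)) hs0
        (fun z => (hmono _).trans (sq_mul_exp_fst_le_expWeight z))
        (integral_const_mul_expWeight_le hu (hN1 _ hp) hw hw) t).trans (hexp0 _ hexp2)
    refine (Finset.sum_le_sum h1).trans ?_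
    rw [Finset.sum_const, nsmul_eq_mul]
    refine mul_le_mul_of_nonneg_right ?_ (by positivity)
    calc (N.card : ℝ) ≤ 5 ^ d₁ := by exact_mod_cast hNc
      _ ≤ 5 ^ d := pow_le_pow_right₀ (by norm_num) (by omega)
  have hP3 : P.real B3 ≤ 5 ^ d * (2 * Real.exp (-(3 * d))) := by
    refine (measureReal_biUnion_finset_le _ _).trans ?_
    have h1 : ∀ q ∈ N', P.real {ω | n * t ≤ |∑ i, inner ℝ (a i ω).2 w * inner ℝ (a i ω).2 q
        - n * ∫ b, inner ℝ b.2 w * inner ℝ b.2 q ∂(designLaw d₁ d₂)|}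
        ≤ 2 * Real.exp (-(3 * d)) := fun q hq =>
      (measureReal_le_abs_sum_sub_le_exp (f := fun b => inner ℝ b.2 w * inner ℝ b.2 q) ha hind
        (by fun_prop) ((integrable_expWeight hu hu hw (hN1' _ hq)).const_mul (16 ^ 4)) hs0
        (fun z => (hmono _).trans (sq_mul_exp_snd_le_expWeight z))
        (integral_const_mul_expWeight_le hu hu hw (hN1' _ hq)) t).trans (hexp0 _ hexp2)
    refine (Finset.sum_le_sum h1).trans ?_
    rw [Finset.sum_const, nsmul_eq_mul]
    refine mul_le_mul_of_nonneg_right ?_ (by positivity)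
    calc (N'.card : ℝ) ≤ 5 ^ d₂ := by exact_mod_cast hNc'
      _ ≤ 5 ^ d := pow_le_pow_right₀ (by norm_num) (by omega)
  -- Each of the three net events costs at most `2 · 2/d²`, hence the `12`.
  have hfive := five_pow_mul_exp_le d (by omega)
  have hU := (measureReal_mono (μ := P) hsub (measure_ne_top _ _)).trans ((measureReal_union_le _ _).trans
    (add_le_add le_rfl ((measureReal_union_le _ _).trans
      (add_le_add le_rfl (measureReal_union_le _ _)))))
  refine (hU.trans (add_le_add hP0 (add_le_add hP1 (add_le_add hP2 hP3)))).trans ?_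
  linarith

end Concentration

/-! ### Concatenated vectors, gradients and the lower bound on `lambdaD`. -/

section Concat

variable {d₁ d₂ : ℕ}

lemma inner_concatPos (p q : EuclideanSpace ℝ (Fin d₁) × EuclideanSpace ℝ (Fin d₂)) :
    inner ℝ (concatPos p) (concatPos q) = inner ℝ p.1 q.1 + inner ℝ p.2 q.2 := by
  simp [concatPos, PiLp.inner_apply]

lemma inner_concatNeg_concatPos
    (p q : EuclideanSpace ℝ (Fin d₁) × EuclideanSpace ℝ (Fin d₂)) :
    inner ℝ (concatNeg p) (concatPos q) = inner ℝ p.1 q.1 - inner ℝ p.2 q.2 := by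
  simp [concatNeg, inner_concatPos, sub_eq_add_neg]

lemma norm_concatPos_sq (p : EuclideanSpace ℝ (Fin d₁) × EuclideanSpace ℝ (Fin d₂)) :
    ‖concatPos p‖ ^ 2 = ‖p.1‖ ^ 2 + ‖p.2‖ ^ 2 := by
  simp only [← real_inner_self_eq_norm_sq, inner_concatPos]

lemma exists_concatPos_eq (v : EuclideanSpace ℝ (Fin d₁ ⊕ Fin d₂)) :
    ∃ p : EuclideanSpace ℝ (Fin d₁) × EuclideanSpace ℝ (Fin d₂), concatPos p = v := by
  refine ⟨(WithLp.toLp 2 fun j => v (Sum.inl j), WithLp.toLp 2 fun j => v (Sum.inr j)), ?_⟩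
  ext j
  cases j <;> rfl

lemma gradient_quarter_sq_abs_inner {E : Type*} [NormedAddCommGroup E] [InnerProductSpace ℝ E]
    [CompleteSpace E] (b z : E) :
    gradient (fun z => 1 / 4 * |inner ℝ b z| ^ 2) z = (1 / 2 * inner ℝ b z : ℝ) • b := by
  apply HasGradientAt.gradient
  rw [hasGradientAt_iff_hasFDerivAt]
  have h : HasFDerivAt (fun z => inner ℝ b z) (innerSL ℝ b) z := (innerSL ℝ b).hasFDerivAt
  have h2 := (h.pow 2).const_mul (1 / 4)
  simp only [sq_abs]
  refine h2.congr_fderiv ?_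
  ext y
  simp
  ring

lemma gradient_fPos (a : EuclideanSpace ℝ (Fin d₁) × EuclideanSpace ℝ (Fin d₂))
    (z : EuclideanSpace ℝ (Fin d₁ ⊕ Fin d₂)) :
    gradient (fPos a) z = (1 / 2 * inner ℝ (concatPos a) z : ℝ) • concatPos a :=
  gradient_quarter_sq_abs_inner _ _

lemma gradient_fNeg (a : EuclideanSpace ℝ (Fin d₁) × EuclideanSpace ℝ (Fin d₂))
    (z : EuclideanSpace ℝ (Fin d₁ ⊕ Fin d₂)) :
    gradient (fNeg a) z = (1 / 2 * inner ℝ (concatNeg a) z : ℝ) • concatNeg a :=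
  gradient_quarter_sq_abs_inner _ _

/-- In the difference of the two gradients the within-block terms cancel and only the cross terms
between the two blocks remain. -/
lemma qFun_concatPos (x a z : EuclideanSpace ℝ (Fin d₁) × EuclideanSpace ℝ (Fin d₂)) :
    qFun x a (concatPos z) =
      1 / 2 * |inner ℝ a.1 x.1 * inner ℝ a.2 z.2 + inner ℝ a.1 z.1 * inner ℝ a.2 x.2| := by
  rw [qFun, gradient_fPos, gradient_fNeg, inner_sub_left, real_inner_smul_left,
    real_inner_smul_left]
  simp only [inner_concatPos, inner_concatNeg_concatPos]
  congr 2
  ring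

lemma pow_four_le_expWeight (u p : EuclideanSpace ℝ (Fin d₁)) (w q : EuclideanSpace ℝ (Fin d₂))
    (a : EuclideanSpace ℝ (Fin d₁) × EuclideanSpace ℝ (Fin d₂)) :
    (inner ℝ a.1 u * inner ℝ a.2 q + inner ℝ a.1 p * inner ℝ a.2 w) ^ 4
      ≤ 16 * (16 ^ 4 * expWeight u p w q a) := by
  set α : ℝ := inner ℝ a.1 u with hα
  set β : ℝ := inner ℝ a.2 w with hβ
  set X : ℝ := inner ℝ a.1 p with hX
  set Y : ℝ := inner ℝ a.2 q with hY
  have key : ∀ y z : ℝ, y ^ 2 + z ^ 2 ≤ α ^ 2 + β ^ 2 + X ^ 2 + Y ^ 2 →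
      (y * z) ^ 4 ≤ 16 ^ 4 * expWeight u p w q a := by
    intro y z hyz
    have h1 := mul_four_le_exp (Real.sq_le_exp y) (Real.sq_le_exp y) (Real.sq_le_exp z)
      (Real.sq_le_exp z) (sq_nonneg _) (sq_nonneg _) (sq_nonneg _) (sq_nonneg _)
    rw [show (y * z) ^ 4 = y ^ 2 * y ^ 2 * (z ^ 2 * z ^ 2) by ring, expWeight_eq]
    refine h1.trans (mul_le_mul_of_nonneg_left (Real.exp_le_exp.2 ?_) (by norm_num))
    nlinarith [sq_nonneg α, sq_nonneg β, sq_nonneg X, sq_nonneg Y]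
  have h1 := key α Y (by nlinarith [sq_nonneg β, sq_nonneg X])
  have h2 := key X β (by nlinarith [sq_nonneg α, sq_nonneg Y])
  have h3 : ∀ b c : ℝ, (b + c) ^ 4 ≤ 8 * (b ^ 4 + c ^ 4) := by
    intro b c
    nlinarith [sq_nonneg (b - c), sq_nonneg (b ^ 2 - c ^ 2), sq_nonneg (b + c), sq_nonneg (b * c),
      sq_nonneg ((b - c) ^ 2), mul_nonneg (sq_nonneg (b - c)) (sq_nonneg (b + c)),
      mul_nonneg (sq_nonneg (b - c)) (add_nonneg (sq_nonneg b) (sq_nonneg c))]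
  linarith [h3 (α * Y) (X * β)]

/-- An absolute constant `c` with `lambdaD x ≥ c ‖x⁽¹⁾‖`. -/
noncomputable def lambdaConst : ℝ := 1 / (64 * Real.sqrt momentConst)

lemma momentConst_pos : 0 < momentConst := lt_of_lt_of_le (by norm_num) le_momentConst

lemma lambdaConst_pos : 0 < lambdaConst := by
  have := Real.sqrt_pos.2 momentConst_pos
  unfold lambdaConst
  positivity

lemma lambdaConst_le_one : lambdaConst ≤ 1 := by
  have h : 1 ≤ Real.sqrt momentConst :=
    Real.one_le_sqrt.2 (le_trans (by norm_num) le_momentConst)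
  rw [lambdaConst, div_le_one (by positivity)]
  linarith

/-- Here `q = (R/2)|Y|` with `𝔼Y² = 1 + 2⟨u,p⟩⟨w,q⟩`. The restriction set excludes the directions
near `± x⋆⁻` where this degenerates, giving `𝔼Y² ≥ 1/2`; together with a bounded fourth moment this
bounds `𝔼|Y|` below. -/
lemma le_integral_qFun {R : ℝ} (hR : 0 < R) {u : EuclideanSpace ℝ (Fin d₁)}
    {w : EuclideanSpace ℝ (Fin d₂)} (hu : ‖u‖ = 1) (hw : ‖w‖ = 1)
    {z : EuclideanSpace ℝ (Fin d₁ ⊕ Fin d₂)} (hz : z ∈ restrictionSet (R • u, R • w)) :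
    lambdaConst * R ≤ ∫ a, qFun (R • u, R • w) a z ∂(designLaw d₁ d₂) := by
  obtain ⟨⟨p, q⟩, rfl⟩ := exists_concatPos_eq z
  obtain ⟨hz1, hz2⟩ := hz
  have hpq : ‖p‖ ^ 2 + ‖q‖ ^ 2 = 1 := by
    have := norm_concatPos_sq (p, q)
    rw [hz1] at this
    simpa using this.symm
  have hp : ‖p‖ ≤ 1 := by nlinarith [norm_nonneg p, sq_nonneg ‖q‖]
  have hq : ‖q‖ ≤ 1 := by nlinarith [norm_nonneg q, sq_nonneg ‖p‖]
  set α : ℝ := inner ℝ u p with hα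
  set β : ℝ := inner ℝ w q with hβ
  have hcross : -(1 / 4) ≤ α * β := by
    have hn : ‖concatPos (R • u, R • w)‖ ^ 2 = 2 * R ^ 2 := by
      rw [norm_concatPos_sq]
      simp only [norm_smul, hu, hw, Real.norm_eq_abs, mul_one, sq_abs]
      ring
    have h1 := pow_le_pow_left₀ (abs_nonneg _) hz2 2
    rw [real_inner_comm, inner_concatNeg_concatPos, sq_abs, mul_pow, hn, real_inner_smul_left,
      real_inner_smul_left, ← mul_sub, mul_pow] at h1
    have h2 : (α - β) ^ 2 ≤ 1 / 2 := by
      have : R ^ 2 * (α - β) ^ 2 ≤ R ^ 2 * (1 / 2) := by linarith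
      exact le_of_mul_le_mul_left this (by positivity)
    -- `4αβ = (α + β)² - (α - β)² ≥ -1/2`.
    nlinarith [sq_nonneg (α + β)]
  set Y : EuclideanSpace ℝ (Fin d₁) × EuclideanSpace ℝ (Fin d₂) → ℝ := fun a =>
    inner ℝ a.1 u * inner ℝ a.2 q + inner ℝ a.1 p * inner ℝ a.2 w with hY
  have hqF : ∀ a, qFun (R • u, R • w) a (concatPos (p, q)) = R / 2 * |Y a| := by
    intro a
    rw [qFun_concatPos]
    simp only [hY, real_inner_smul_right]
    rw [show R * inner ℝ a.1 u * inner ℝ a.2 q + inner ℝ a.1 p * (R * inner ℝ a.2 w)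
      = R * (inner ℝ a.1 u * inner ℝ a.2 q + inner ℝ a.1 p * inner ℝ a.2 w) by ring,
      abs_mul, abs_of_pos hR]
    ring
  have hYm : Measurable Y := by fun_prop
  obtain ⟨hi1, hm1⟩ := integral_prod_inner u u q q
  obtain ⟨hi2, hm2⟩ := integral_prod_inner p p w w
  obtain ⟨hi3, hm3⟩ := integral_prod_inner u p w q
  have hYsq : (fun a => Y a ^ 2) = fun a : EuclideanSpace ℝ (Fin d₁) × EuclideanSpace ℝ (Fin d₂) =>
      inner ℝ a.1 u * inner ℝ a.2 q * (inner ℝ a.1 u * inner ℝ a.2 q)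
      + inner ℝ a.1 p * inner ℝ a.2 w * (inner ℝ a.1 p * inner ℝ a.2 w)
      + 2 * (inner ℝ a.1 u * inner ℝ a.2 w * (inner ℝ a.1 p * inner ℝ a.2 q)) := by
    ext a
    simp only [hY]
    ring
  have hYi : Integrable (fun a => Y a ^ 2) (designLaw d₁ d₂) := by
    rw [hYsq]
    exact (hi1.add hi2).add (hi3.const_mul 2)
  have hYint : 1 / 2 ≤ ∫ a, Y a ^ 2 ∂(designLaw d₁ d₂) := by
    rw [hYsq, integral_add (by exact hi1.add hi2) (hi3.const_mul 2), integral_add hi1 hi2,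
      integral_const_mul, hm1, hm2, hm3]
    simp only [real_inner_self_eq_norm_sq, hu, hw]
    linarith
  have hYabs : Integrable (fun a => |Y a|) (designLaw d₁ d₂) := by
    refine ((integrable_const (1 : ℝ)).add hYi).mono' (by fun_prop) (.of_forall fun a => ?_)
    simp only [Real.norm_eq_abs, abs_abs, Pi.add_apply]
    nlinarith [sq_abs (Y a), sq_nonneg (|Y a| - 1)]
  have hK := momentConst_pos
  -- With `L² = 64K` the fourth-moment correction `16K/L²` is `1/4`, half of the lower bound on
  -- `𝔼Y²`.
  set L : ℝ := 8 * Real.sqrt momentConst with hL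
  have hL0 : 0 < L := by
    have := Real.sqrt_pos.2 hK
    positivity
  have hL2 : L ^ 2 = 64 * momentConst := by
    rw [hL, mul_pow, Real.sq_sqrt hK.le]
    norm_num
  have hW := (integrable_expWeight hu.le hp hw.le hq).const_mul (16 ^ 4)
  -- If `|Y| ≤ L` then `Y² ≤ L|Y|`; otherwise `Y² ≤ Y⁴/L²`, which the weight dominates.
  have hpt : ∀ a, Y a ^ 2 - 16 / L ^ 2 * (16 ^ 4 * expWeight u p w q a) ≤ L * |Y a| := by
    intro a
    have h4 := pow_four_le_expWeight u p w q a
    have h0 : 0 ≤ 16 / L ^ 2 * (16 ^ 4 * expWeight u p w q a) :=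
      mul_nonneg (by positivity) (mul_nonneg (by norm_num)
        (zero_le_one.trans (one_le_expWeight a)))
    have hsq := sq_abs (Y a)
    rcases le_total |Y a| L with h | h
    · nlinarith [abs_nonneg (Y a)]
    · have h1 : Y a ^ 2 ≤ 16 / L ^ 2 * (16 ^ 4 * expWeight u p w q a) := by
        rw [div_mul_eq_mul_div, le_div_iff₀ (by positivity)]
        refine le_trans ?_ h4
        have h2 : L ^ 2 ≤ Y a ^ 2 := by
          rw [← hsq]
          exact pow_le_pow_left₀ hL0.le h 2
        change Y a ^ 2 * L ^ 2 ≤ Y a ^ 4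
        nlinarith [sq_nonneg (Y a)]
      nlinarith [abs_nonneg (Y a)]
  have hint := integral_mono (hYi.sub (hW.const_mul (16 / L ^ 2))) (hYabs.const_mul L) hpt
  have hint2 : ∫ a, (Y a ^ 2 - 16 / L ^ 2 * (16 ^ 4 * expWeight u p w q a)) ∂(designLaw d₁ d₂)
      = ∫ a, Y a ^ 2 ∂(designLaw d₁ d₂)
        - 16 / L ^ 2 * ∫ a, 16 ^ 4 * expWeight u p w q a ∂(designLaw d₁ d₂) := by
    rw [integral_sub hYi (hW.const_mul (16 / L ^ 2)), integral_const_mul (16 / L ^ 2)]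
  have hint3 : 16 / L ^ 2 * ∫ a, 16 ^ 4 * expWeight u p w q a ∂(designLaw d₁ d₂) ≤ 1 / 4 := by
    calc _ ≤ 16 / L ^ 2 * momentConst := mul_le_mul_of_nonneg_left
          (integral_const_mul_expWeight_le hu.le hp hw.le hq) (by positivity)
      _ = 1 / 4 := by rw [hL2]; field_simp; norm_num
  have hfin : 1 / 4 ≤ L * ∫ a, |Y a| ∂(designLaw d₁ d₂) := by
    rw [← integral_const_mul]
    refine le_trans ?_ hint
    simp only [Pi.sub_apply]
    linarith
  simp only [hqF]
  rw [integral_const_mul]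
  have h5 : 1 / (4 * L) ≤ ∫ a, |Y a| ∂(designLaw d₁ d₂) := by
    rw [div_le_iff₀ (by positivity)]
    linarith
  calc lambdaConst * R = R / 2 * (1 / (4 * L)) := by
        rw [lambdaConst, hL]; field_simp; norm_num
    _ ≤ _ := mul_le_mul_of_nonneg_left h5 (by positivity)

/-- Equal block norms make `x` orthogonal to `x⁻`, so the normalised `x` qualifies. Nonemptiness
matters because the real infimum of the empty set is `0`. -/
lemma restrictionSet_nonempty {x : EuclideanSpace ℝ (Fin d₁) × EuclideanSpace ℝ (Fin d₂)}
    (hx : x.1 ≠ 0) (hxx : ‖x.1‖ = ‖x.2‖) : (restrictionSet x).Nonempty := by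
  have hpos : 0 < ‖concatPos x‖ := by
    have h := norm_concatPos_sq x
    have := norm_pos_iff.2 hx
    by_contra hcon
    have h0 : ‖concatPos x‖ = 0 := le_antisymm (not_lt.1 hcon) (norm_nonneg _)
    rw [h0] at h
    nlinarith [sq_nonneg ‖x.2‖]
  refine ⟨‖concatPos x‖⁻¹ • concatPos x, ?_, ?_⟩
  · rw [norm_smul, norm_inv, norm_norm, inv_mul_cancel₀ hpos.ne']
  · rw [real_inner_smul_left, real_inner_comm, inner_concatNeg_concatPos,
      real_inner_self_eq_norm_sq, real_inner_self_eq_norm_sq, hxx]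
    simp

lemma le_lambdaD {R : ℝ} (hR : 0 < R) {u : EuclideanSpace ℝ (Fin d₁)}
    {w : EuclideanSpace ℝ (Fin d₂)} (hu : ‖u‖ = 1) (hw : ‖w‖ = 1) :
    lambdaConst * R ≤ lambdaD (R • u, R • w) := by
  refine le_csInf (Set.Nonempty.image _ (restrictionSet_nonempty ?_ ?_)) ?_
  · exact smul_ne_zero hR.ne' (norm_ne_zero_iff.1 (by rw [hu]; norm_num))
  · simp only [norm_smul, hu, hw]
  · rintro _ ⟨z, hz, rfl⟩
    exact le_integral_qFun hR hu hw hz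

end Concat

/-! ### Top eigenpairs and Rayleigh quotients. -/

section Rayleigh

variable {E : Type*} [NormedAddCommGroup E] [InnerProductSpace ℝ E] [FiniteDimensional ℝ E]
  {T : E →ₗ[ℝ] E}

/-- In finite dimension the supremum of the Rayleigh quotient is itself an eigenvalue, hence at most
`lam`. -/
lemma LinearMap.IsSymmetric.inner_le_of_isGreatest_hasEigenvalue [Nontrivial E]
    (hT : T.IsSymmetric) {lam : ℝ} (hlam : IsGreatest {μ : ℝ | Module.End.HasEigenvalue T μ} lam)
    (v : E) : inner ℝ (T v) v ≤ lam * ‖v‖ ^ 2 := by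
  rcases eq_or_ne v 0 with rfl | hv
  · simp
  have hbdd : BddAbove (Set.range fun x : { x : E // x ≠ 0 } =>
      RCLike.re (inner ℝ (T x) (x : E)) / ‖(x : E)‖ ^ 2) := by
    refine ⟨‖T.toContinuousLinearMap‖, ?_⟩
    rintro _ ⟨⟨x, hx⟩, rfl⟩
    have hx' := norm_pos_iff.2 hx
    have h1 : inner ℝ (T x) x ≤ ‖T x‖ * ‖x‖ := real_inner_le_norm _ _
    have h2 : ‖T x‖ ≤ ‖T.toContinuousLinearMap‖ * ‖x‖ := T.toContinuousLinearMap.le_opNorm x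
    simp only [RCLike.re_to_real]
    rw [div_le_iff₀ (by positivity)]
    nlinarith
  have h1 := le_ciSup hbdd ⟨v, hv⟩
  have h2 := hlam.2 hT.hasEigenvalue_iSup_of_finiteDimensional
  have h3 := h1.trans h2
  simp only [RCLike.re_to_real] at h3
  rwa [div_le_iff₀ (by have := norm_pos_iff.2 hv; positivity)] at h3

lemma LinearMap.IsSymmetric.exists_isGreatest_hasEigenvalue [Nontrivial E]
    (hT : T.IsSymmetric) : ∃ lam : ℝ, IsGreatest {μ : ℝ | Module.End.HasEigenvalue T μ} lam := by
  have hfin : Set.Finite {μ : ℝ | Module.End.HasEigenvalue T μ} :=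
    Module.End.finite_hasEigenvalue (f := T)
  have hne : {μ : ℝ | Module.End.HasEigenvalue T μ}.Nonempty :=
    ⟨_, hT.hasEigenvalue_iSup_of_finiteDimensional⟩
  obtain ⟨lam, h1, h2⟩ := hfin.exists_maximal hne
  exact ⟨lam, h1, fun μ hμ => (le_total μ lam).elim (fun h => h) fun h => h2 hμ h⟩

end Rayleigh

lemma exists_isTopEigenpair {ι : Type*} [Fintype ι] [DecidableEq ι] [Nonempty ι]
    {S : Matrix ι ι ℝ} (hS : S.IsHermitian) : ∃ lam v, IsTopEigenpair S lam v := by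
  obtain ⟨lam, hlam⟩ :=
    (Matrix.isSymmetric_toEuclideanLin_iff.2 hS).exists_isGreatest_hasEigenvalue
  obtain ⟨v, hv⟩ := hlam.1.exists_hasEigenvector
  have hv0 : 0 < ‖v‖ := norm_pos_iff.2 hv.2
  refine ⟨lam, ‖v‖⁻¹ • v, hlam, ⟨?_, ?_⟩, ?_⟩
  · exact Submodule.smul_mem _ _ hv.1
  · exact smul_ne_zero (by positivity) hv.2
  · rw [norm_smul, norm_inv, norm_norm, inv_mul_cancel₀ hv0.ne']

lemma inner_toEuclideanLin_vecMulVec {ι : Type*} [Fintype ι] [DecidableEq ι]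
    (b v : EuclideanSpace ℝ ι) :
    inner ℝ (Matrix.toEuclideanLin (Matrix.vecMulVec b.ofLp b.ofLp) v) v = inner ℝ b v ^ 2 := by
  have h : Matrix.toEuclideanLin (Matrix.vecMulVec b.ofLp b.ofLp) v = (inner ℝ b v : ℝ) • b := by
    ext i
    rw [Matrix.toLpLin_apply]
    simp [Matrix.vecMulVec_mulVec, PiLp.inner_apply, dotProduct, mul_comm]
  rw [h, real_inner_smul_left, sq]

/-! ### Deterministic perturbation analysis of the spectral anchor. -/

section Spectral

variable {d₁ d₂ n : ℕ}

lemma isHermitian_spectralMatrix (x : EuclideanSpace ℝ (Fin d₁) × EuclideanSpace ℝ (Fin d₂))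
    (a : Fin n → EuclideanSpace ℝ (Fin d₁) × EuclideanSpace ℝ (Fin d₂)) :
    (spectralMatrix x a).IsHermitian := by
  ext i j
  simp only [spectralMatrix, Matrix.conjTranspose_apply, Matrix.smul_apply, Matrix.sum_apply,
    Matrix.sub_apply, Matrix.vecMulVec_apply, star_trivial, mul_comm]

lemma spectralMatrix_neg (x : EuclideanSpace ℝ (Fin d₁) × EuclideanSpace ℝ (Fin d₂))
    (a : Fin n → EuclideanSpace ℝ (Fin d₁) × EuclideanSpace ℝ (Fin d₂)) :
    spectralMatrix (-x) a = spectralMatrix x a := by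
  simp [spectralMatrix, bilinearObs]

/-- Polarisation, `(A + B)² - (A - B)² = 4AB`, leaves exactly the products controlled by
`MomentsClose.prod`. -/
lemma inner_spectralMatrix (x p : EuclideanSpace ℝ (Fin d₁) × EuclideanSpace ℝ (Fin d₂))
    (a : Fin n → EuclideanSpace ℝ (Fin d₁) × EuclideanSpace ℝ (Fin d₂)) :
    inner ℝ (Matrix.toEuclideanLin (spectralMatrix x a) (concatPos p)) (concatPos p)
      = 2 / n * ∑ i, inner ℝ (a i).1 x.1 * inner ℝ (a i).2 x.2
        * (inner ℝ (a i).1 p.1 * inner ℝ (a i).2 p.2) := by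
  simp only [spectralMatrix, map_smul, map_sum, map_sub, LinearMap.smul_apply,
    LinearMap.sum_apply, LinearMap.sub_apply, real_inner_smul_left, sum_inner, inner_sub_left,
    inner_toEuclideanLin_vecMulVec, inner_concatPos, inner_concatNeg_concatPos, bilinearObs,
    Finset.mul_sum]
  refine Finset.sum_congr rfl fun i _ => ?_
  rw [real_inner_comm (a i).2 x.2]
  ring

lemma MomentsClose.neg {r : ℝ} {u : EuclideanSpace ℝ (Fin d₁)} {w : EuclideanSpace ℝ (Fin d₂)}
    {a : Fin n → EuclideanSpace ℝ (Fin d₁) × EuclideanSpace ℝ (Fin d₂)}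
    (h : MomentsClose r u w a) : MomentsClose r (-u) (-w) a := by
  refine ⟨fun p q => ?_, fun p => ?_, fun q => ?_⟩
  · simpa using h.prod p q
  · have := h.fst p
    rw [← abs_neg] at this
    simpa [neg_add_eq_sub] using this
  · have := h.snd q
    rw [← abs_neg] at this
    simpa [neg_add_eq_sub] using this

variable {R η : ℝ} {u : EuclideanSpace ℝ (Fin d₁)} {w : EuclideanSpace ℝ (Fin d₂)}
  {a : Fin n → EuclideanSpace ℝ (Fin d₁) × EuclideanSpace ℝ (Fin d₂)}

lemma MomentsClose.abs_inner_spectralMatrix_sub_le (hn : 0 < n) (hη : 0 ≤ η)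
    (h : MomentsClose (η * n) u w a)
    (p : EuclideanSpace ℝ (Fin d₁) × EuclideanSpace ℝ (Fin d₂)) :
    |inner ℝ (Matrix.toEuclideanLin (spectralMatrix (R • u, R • w) a) (concatPos p)) (concatPos p)
      - 2 * R ^ 2 * (inner ℝ u p.1 * inner ℝ w p.2)| ≤ η * R ^ 2 * ‖concatPos p‖ ^ 2 := by
  have hn' : (0 : ℝ) < n := by exact_mod_cast hn
  have h1 := h.prod p.1 p.2
  rw [inner_spectralMatrix]
  simp only [real_inner_smul_right]
  have h2 : 2 / (n : ℝ) * ∑ i, R * inner ℝ (a i).1 u * (R * inner ℝ (a i).2 w)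
        * (inner ℝ (a i).1 p.1 * inner ℝ (a i).2 p.2) - 2 * R ^ 2 * (inner ℝ u p.1 * inner ℝ w p.2)
      = 2 * R ^ 2 / n * (∑ i, inner ℝ (a i).1 u * inner ℝ (a i).2 w
        * (inner ℝ (a i).1 p.1 * inner ℝ (a i).2 p.2) - n * (inner ℝ u p.1 * inner ℝ w p.2)) := by
    rw [mul_sub, Finset.mul_sum, Finset.mul_sum]
    congr 1
    · exact Finset.sum_congr rfl fun i _ => by ring
    · field_simp
  rw [h2, abs_mul, abs_of_nonneg (by positivity)]
  refine (mul_le_mul_of_nonneg_left h1 (by positivity)).trans ?_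
  rw [norm_concatPos_sq]
  have h3 : 2 * R ^ 2 / n * (η * n * ‖p.1‖ * ‖p.2‖) = η * R ^ 2 * (2 * ‖p.1‖ * ‖p.2‖) := by
    field_simp
  rw [h3]
  refine mul_le_mul_of_nonneg_left ?_ (by positivity)
  nlinarith [sq_nonneg (‖p.1‖ - ‖p.2‖)]

/-- In the sum of the two gradients the cross terms between blocks cancel, so only the `fst` and
`snd` moments enter. The norm is read off by pairing the error `D` with itself. -/
lemma MomentsClose.norm_half_sub_gradient_le (hn : 0 < n) (hη : 0 ≤ η) (hR : 0 ≤ R)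
    (h : MomentsClose (η * n) u w a) :
    ‖(1 / 2 : ℝ) • concatPos (R • u, R • w) - (1 / (2 * (n : ℝ))) •
      ∑ i, (gradient (fPos (a i)) (concatPos (R • u, R • w))
        + gradient (fNeg (a i)) (concatPos (R • u, R • w)))‖ ≤ η * R := by
  have hn' : (0 : ℝ) < n := by exact_mod_cast hn
  set D := (1 / 2 : ℝ) • concatPos (R • u, R • w) - (1 / (2 * (n : ℝ))) •
      ∑ i, (gradient (fPos (a i)) (concatPos (R • u, R • w))
        + gradient (fNeg (a i)) (concatPos (R • u, R • w))) with hD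
  obtain ⟨p, hp⟩ := exists_concatPos_eq D
  have h1 : inner ℝ D (concatPos p) = -(R / (2 * n)) *
      ((∑ i, inner ℝ (a i).1 u * inner ℝ (a i).1 p.1 - n * inner ℝ u p.1)
      + (∑ i, inner ℝ (a i).2 w * inner ℝ (a i).2 p.2 - n * inner ℝ w p.2)) := by
    rw [hD, inner_sub_left, real_inner_smul_left, real_inner_smul_left, sum_inner]
    simp only [inner_add_left, gradient_fPos, gradient_fNeg, real_inner_smul_left,
      inner_concatPos, inner_concatNeg_concatPos, real_inner_smul_right]
    have h2 : ∑ i, (1 / 2 * (R * inner ℝ (a i).1 u + R * inner ℝ (a i).2 w)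
          * (inner ℝ (a i).1 p.1 + inner ℝ (a i).2 p.2)
        + 1 / 2 * (R * inner ℝ (a i).1 u - R * inner ℝ (a i).2 w)
          * (inner ℝ (a i).1 p.1 - inner ℝ (a i).2 p.2))
        = R * (∑ i, inner ℝ (a i).1 u * inner ℝ (a i).1 p.1
          + ∑ i, inner ℝ (a i).2 w * inner ℝ (a i).2 p.2) := by
      rw [← Finset.sum_add_distrib, Finset.mul_sum]
      exact Finset.sum_congr rfl fun i _ => by ring
    rw [h2]
    field_simp
    ring
  have h2 : ‖p.1‖ ≤ ‖D‖ ∧ ‖p.2‖ ≤ ‖D‖ := by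
    have h3 := norm_concatPos_sq p
    rw [hp] at h3
    constructor <;> refine le_of_sq_le_sq ?_ (norm_nonneg _) <;>
      nlinarith [sq_nonneg ‖p.1‖, sq_nonneg ‖p.2‖]
  have h3 : ‖D‖ ^ 2 ≤ η * R * ‖D‖ := by
    rw [← real_inner_self_eq_norm_sq]
    nth_rewrite 2 [← hp]
    rw [h1]
    refine (le_abs_self _).trans ?_
    rw [abs_mul, abs_neg, abs_of_nonneg (by positivity)]
    have h4 := (abs_add_le _ _).trans (add_le_add (h.fst p.1) (h.snd p.2))
    refine (mul_le_mul_of_nonneg_left h4 (by positivity)).trans ?_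
    have h5 : R / (2 * n) * (η * n * ‖p.1‖ + η * n * ‖p.2‖) = η * R * ((‖p.1‖ + ‖p.2‖) / 2) := by
      field_simp
    rw [h5]
    exact mul_le_mul_of_nonneg_left (by linarith [h2.1, h2.2]) (by positivity)
  by_contra! hcon
  have h0 : 0 < ‖D‖ := lt_of_le_of_lt (by positivity) hcon
  nlinarith

/-- No eigengap argument is needed. The two lower bounds on `lam` and on `⟨v,X⟩²/2` give
`√(lam/2)⟨v,X⟩ ≥ (1 - 2e²)R²`, and expanding the square leaves at most `(5/2)e²R²`. -/
lemma norm_sqrt_smul_sub_half_le {E : Type*} [NormedAddCommGroup E] [InnerProductSpace ℝ E]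
    {v X : E} {lam e R : ℝ} (hR : 0 ≤ R) (he : 0 ≤ e) (he' : e ≤ 1 / 2) (hv : ‖v‖ = 1)
    (hX : ‖X‖ ^ 2 = 2 * R ^ 2) (hvX : 0 ≤ inner ℝ v X) (h1 : (1 - e ^ 2) * R ^ 2 ≤ lam)
    (h2 : lam ≤ (1 + e ^ 2) * R ^ 2) (h3 : lam ≤ inner ℝ v X ^ 2 / 2 + e ^ 2 * R ^ 2) :
    ‖Real.sqrt (lam / 2) • v - (1 / 2 : ℝ) • X‖ ≤ 2 * e * R := by
  have he2 : e ^ 2 ≤ 1 / 4 := by nlinarith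
  have hR2 := sq_nonneg R
  have hlam : 0 ≤ lam := le_trans (mul_nonneg (by linarith) hR2) h1
  set s := Real.sqrt (lam / 2) with hs
  have hs0 : 0 ≤ s := Real.sqrt_nonneg _
  have hs2 : s ^ 2 = lam / 2 := Real.sq_sqrt (by linarith)
  set c : ℝ := inner ℝ v X with hc
  have hprod : (1 - 2 * e ^ 2) * R ^ 2 ≤ s * c := by
    refine le_of_sq_le_sq ?_ (by positivity)
    have h4 : (1 - 2 * e ^ 2) * R ^ 2 ≤ c ^ 2 / 2 := by linarith
    have h5 : (1 - 2 * e ^ 2) * R ^ 2 ≤ lam := by nlinarith [mul_nonneg (sq_nonneg e) hR2]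
    have h6 : 0 ≤ (1 - 2 * e ^ 2) * R ^ 2 := mul_nonneg (by linarith) hR2
    have h7 := mul_le_mul h5 h4 h6 hlam
    rw [mul_pow s c, hs2]
    nlinarith
  refine le_of_sq_le_sq ?_ (by positivity)
  rw [norm_sub_sq_real, norm_smul, norm_smul, real_inner_smul_left, real_inner_smul_right, hv,
    mul_pow ‖(1 / 2 : ℝ)‖, hX, Real.norm_eq_abs, mul_one, sq_abs, hs2, Real.norm_eq_abs, sq_abs]
  nlinarith [mul_nonneg (sq_nonneg e) hR2]

/-- Testing the form at `X` bounds `lam` below; evaluating it at `v` and using `2yz ≤ (y + z)²/2`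
bounds `lam` by `⟨v,X⟩²/2 + e²R²`. The errors `2eR` for the anchor and `e²R` for the gradients add
up to at most `3eR`. -/
lemma MomentsClose.isTopEigenpair {e : ℝ} (hn : 0 < n) (hR : 0 < R) (hu : ‖u‖ = 1)
    (hw : ‖w‖ = 1) (he : 0 ≤ e) (he' : e ≤ 1 / 2) (h : MomentsClose (e ^ 2 * n) u w a) {lam : ℝ}
    {v : EuclideanSpace ℝ (Fin d₁ ⊕ Fin d₂)}
    (hv : IsTopEigenpair (spectralMatrix (R • u, R • w) a) lam v) :
    (1 - e ^ 2) * R ^ 2 ≤ lam ∧ (0 ≤ inner ℝ v (concatPos (R • u, R • w)) →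
      ‖spectralAnchor lam v - (1 / (2 * (n : ℝ))) •
      ∑ i, (gradient (fPos (a i)) (concatPos (R • u, R • w))
        + gradient (fNeg (a i)) (concatPos (R • u, R • w)))‖ ≤ 3 * e * R) := by
  obtain ⟨hgreat, heig, hv1⟩ := hv
  have : Nontrivial (EuclideanSpace ℝ (Fin d₁ ⊕ Fin d₂)) := ⟨v, 0, heig.2⟩
  set X := concatPos (R • u, R • w) with hX
  have hX2 : ‖X‖ ^ 2 = 2 * R ^ 2 := by
    rw [hX, norm_concatPos_sq]
    simp only [norm_smul, hu, hw, Real.norm_eq_abs, mul_one, sq_abs]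
    ring
  have hlow : (1 - e ^ 2) * R ^ 2 ≤ lam := by
    have h1 := (Matrix.isSymmetric_toEuclideanLin_iff.2
      (isHermitian_spectralMatrix (R • u, R • w) a)).inner_le_of_isGreatest_hasEigenvalue hgreat X
    have h2 := (abs_le.1 (h.abs_inner_spectralMatrix_sub_le (R := R) hn (sq_nonneg e)
      (R • u, R • w))).1
    simp only [real_inner_smul_right, real_inner_self_eq_norm_sq, hu, hw] at h2
    rw [← hX] at h2
    rw [hX2] at h1 h2
    have h3 : (2 * R ^ 2) * ((1 - e ^ 2) * R ^ 2) ≤ (2 * R ^ 2) * lam := by nlinarith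
    exact le_of_mul_le_mul_left h3 (by positivity)
  refine ⟨hlow, fun hpos => ?_⟩
  obtain ⟨p, rfl⟩ := exists_concatPos_eq v
  have hq := (abs_le.1 (h.abs_inner_spectralMatrix_sub_le (R := R) hn (sq_nonneg e) p)).2
  rw [heig.apply_eq_smul, real_inner_smul_left, real_inner_self_eq_norm_sq, hv1] at hq
  have hpX : inner ℝ (concatPos p) X = R * (inner ℝ u p.1 + inner ℝ w p.2) := by
    rw [hX, inner_concatPos, real_inner_smul_right, real_inner_smul_right, real_inner_comm,
      real_inner_comm w]
    ring
  have h3 : lam ≤ inner ℝ (concatPos p) X ^ 2 / 2 + e ^ 2 * R ^ 2 := by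
    rw [hpX, mul_pow]
    nlinarith [mul_nonneg (sq_nonneg R) (sq_nonneg ((inner ℝ u p.1 : ℝ) - inner ℝ w p.2))]
  have h2 : lam ≤ (1 + e ^ 2) * R ^ 2 := by
    have h4 := abs_real_inner_le_norm (concatPos p) X
    have h5 := pow_le_pow_left₀ (abs_nonneg _) h4 2
    rw [sq_abs, hv1, one_mul, hX2] at h5
    linarith
  have hA := norm_sqrt_smul_sub_half_le hR.le he he' hv1 hX2 hpos hlow h2 h3
  have hB := h.norm_half_sub_gradient_le hn (sq_nonneg e) hR.le
  refine (norm_sub_le_norm_sub_add_norm_sub _ ((1 / 2 : ℝ) • X) _).trans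
    ((add_le_add hA hB).trans ?_)
  nlinarith [mul_nonneg he hR.le]

end Spectral

/-! ### Choice of constants and conclusion. -/

theorem mainTheorem5 (ε : ℝ) (hε₀ : 0 < ε) (hε₁ : ε < 1) :
    ∃ C c : ℝ, 0 < C ∧ 0 < c ∧
      ∀ (d₁ d₂ n : ℕ) (δ : ℝ), 0 < δ → δ ≤ 1 →
      C * (((d₁ + d₂ : ℕ) : ℝ) + Real.log (4 / δ)) * Real.log ((d₁ + d₂ : ℕ) : ℝ) ≤ (n : ℝ) →
      ∀ x : EuclideanSpace ℝ (Fin d₁) × EuclideanSpace ℝ (Fin d₂),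
      x.1 ≠ 0 → x.2 ≠ 0 → ‖x.1‖ = ‖x.2‖ →
      ∀ (Ω : Type*) [MeasurableSpace Ω] (P : Measure Ω) [IsProbabilityMeasure P]
        (a : Fin n → Ω → EuclideanSpace ℝ (Fin d₁) × EuclideanSpace ℝ (Fin d₂)),
      (∀ i, HasLaw (a i) (designLaw d₁ d₂) P) → iIndepFun a P →
      ∃ E : Set Ω, MeasurableSet E ∧
        ENNReal.ofReal (1 - c * (((d₁ + d₂ : ℕ) : ℝ) ^ 2)⁻¹) ≤ P E ∧
        ∀ ω ∈ E,
          (∃ lam v, IsTopEigenpair (spectralMatrix x (fun i => a i ω)) lam v) ∧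
          ∀ lam v, IsTopEigenpair (spectralMatrix x (fun i => a i ω)) lam v →
            0 ≤ lam ∧
            (0 ≤ inner ℝ v (concatPos x) →
              IsApproxOracle ε x (fun i => a i ω) (spectralAnchor lam v)) ∧
            (inner ℝ v (concatPos x) ≤ 0 →
              IsApproxOracle ε (-x) (fun i => a i ω) (spectralAnchor lam v)) := by
  have hc0 := lambdaConst_pos
  have hc1 := lambdaConst_le_one
  -- Chosen so that the total error `3eR` equals `(1-ε)/2 · lambdaConst · R`.
  set e : ℝ := (1 - ε) * lambdaConst / 6 with he_def
  have he : 0 < e := by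
    have : 0 < 1 - ε := by linarith
    positivity
  have he1 : e ≤ 1 / 6 := by
    rw [he_def]
    have : (1 - ε) * lambdaConst ≤ 1 * 1 :=
      mul_le_mul (by linarith) hc1 hc0.le (by norm_num)
    linarith
  -- Turns the concentration radius `8tn` into `e²n`.
  set t : ℝ := e ^ 2 / 8 with ht_def
  have ht : 0 < t := by positivity
  have ht1 : t ≤ 1 / 2 := by rw [ht_def]; nlinarith
  have hK := momentConst_pos
  refine ⟨48 * momentConst / t ^ 2, 192 / t * gaussianExpMoment ^ 2 + 12, by positivity,
    by positivity, ?_⟩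
  intro d₁ d₂ n δ hδ hδ1 hn x hx1 hx2 hxx Ω _ P _ a ha hind
  have hpos : ∀ {d : ℕ} {y : EuclideanSpace ℝ (Fin d)}, y ≠ 0 → 0 < d := by
    intro d y hy
    rcases Nat.eq_zero_or_pos d with rfl | h
    · exact absurd (Subsingleton.elim _ _) hy
    · exact h
  have hd1 := hpos hx1
  have hd2 := hpos hx2
  have hd : 2 ≤ d₁ + d₂ := by omega
  have hdR : (2 : ℝ) ≤ ((d₁ + d₂ : ℕ) : ℝ) := by exact_mod_cast hd
  have hlogd : 0 < Real.log ((d₁ + d₂ : ℕ) : ℝ) := Real.log_pos (by linarith)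
  have hn' : 48 * momentConst / t ^ 2 * ((d₁ + d₂ : ℕ) : ℝ) * Real.log ((d₁ + d₂ : ℕ) : ℝ)
      ≤ (n : ℝ) := by
    refine le_trans ?_ hn
    have : 0 ≤ Real.log (4 / δ) := Real.log_nonneg (by rw [le_div_iff₀ hδ]; linarith)
    gcongr
    linarith
  have hn0 : 0 < n := by
    have : (0 : ℝ) < n := lt_of_lt_of_le (by positivity) hn'
    exact_mod_cast this
  set R := ‖x.1‖ with hR_def
  have hR : 0 < R := norm_pos_iff.2 hx1
  set u := R⁻¹ • x.1 with hu_def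
  set w := R⁻¹ • x.2 with hw_def
  have hu : ‖u‖ = 1 := by
    rw [hu_def, norm_smul, norm_inv, Real.norm_eq_abs, abs_of_pos hR, ← hR_def,
      inv_mul_cancel₀ hR.ne']
  have hw : ‖w‖ = 1 := by
    rw [hw_def, norm_smul, norm_inv, Real.norm_eq_abs, abs_of_pos hR, ← hxx,
      inv_mul_cancel₀ hR.ne']
  have hx : x = (R • u, R • w) := by
    rw [hu_def, hw_def, smul_inv_smul₀ hR.ne', smul_inv_smul₀ hR.ne']
  have hxneg : -x = (R • (-u), R • (-w)) := by
    rw [hx, Prod.neg_mk, smul_neg, smul_neg]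
  have hbad := measureReal_not_momentsClose_le ht ht1 hd hn' hu.le hw.le ha hind
  set B : Set Ω := {ω | ¬ MomentsClose (8 * t * n) u w (fun i => a i ω)} with hB
  -- Measurability of `B` is never established; its measurable hull has the same measure.
  refine ⟨(toMeasurable P B)ᶜ, (measurableSet_toMeasurable P B).compl, ?_, fun ω hω => ?_⟩
  · rw [prob_compl_eq_one_sub (measurableSet_toMeasurable P B), measure_toMeasurable,
      ENNReal.ofReal_sub _ (by positivity), ENNReal.ofReal_one]
    refine tsub_le_tsub_left ?_ _
    rw [← ofReal_measureReal]
    exact ENNReal.ofReal_le_ofReal hbad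
  have hclose : MomentsClose (e ^ 2 * n) u w (fun i => a i ω) := by
    have h1 : ω ∉ B := fun h => hω (subset_toMeasurable P B h)
    have h2 : 8 * t * n = e ^ 2 * n := by rw [ht_def]; ring
    rw [← h2]
    exact not_not.1 h1
  have : Nonempty (Fin d₁ ⊕ Fin d₂) := ⟨Sum.inl ⟨0, hd1⟩⟩
  have hbound : ∀ {u' : EuclideanSpace ℝ (Fin d₁)} {w' : EuclideanSpace ℝ (Fin d₂)},
      ‖u'‖ = 1 → ‖w'‖ = 1 → 3 * e * R ≤ (1 - ε) / 2 * lambdaD (R • u', R • w') := by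
    intro u' w' hu' hw'
    have h1 := mul_le_mul_of_nonneg_left (le_lambdaD hR hu' hw')
      (show 0 ≤ (1 - ε) / 2 by linarith)
    refine le_trans (le_of_eq ?_) h1
    rw [he_def]
    ring
  refine ⟨exists_isTopEigenpair (isHermitian_spectralMatrix x _), fun lam v hv => ?_⟩
  -- The matrix is even in `x`, so the same eigenpair serves `-x`, and the moment bounds pass to
  -- `(-u, -w)`; the second sign case reduces to the first.
  have hvneg := hv
  rw [← spectralMatrix_neg, hxneg] at hvneg
  rw [hx] at hv
  have hA := hclose.isTopEigenpair hn0 hR hu hw he.le (by linarith) hv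
  have hA' := hclose.neg.isTopEigenpair hn0 hR (by rwa [norm_neg]) (by rwa [norm_neg]) he.le
    (by linarith) hvneg
  refine ⟨le_trans ?_ hA.1, fun hpos => ?_, fun hneg => ?_⟩
  · exact mul_nonneg (by nlinarith) (sq_nonneg R)
  · rw [hx] at hpos ⊢
    exact (hA.2 hpos).trans (hbound hu hw)
  · have hneg' : 0 ≤ inner ℝ v (concatPos (R • (-u), R • (-w))) := by
      rw [← hxneg]
      have : concatPos (-x) = -concatPos x := by
        ext j
        cases j <;> rfl
      rw [this, inner_neg_right]
      linarith
    rw [hxneg]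
    exact (hA'.2 hneg').trans (hbound (by rwa [norm_neg]) (by rwa [norm_neg]))
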